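/- **Setting.** Let $p\ge 1$, let $f_i:\mathbb R^{n_i}\to\mathbb R\cup\{+\infty\}$ ($i=1,\dots,p$) be proper, $h:\mathbb R^q\to\mathbb R$, $A_i\in\mathbb R^{m\times n_i}$, $0\ne B\in\mathbb R^{m\times q}$, $b\in\mathbb R^m$, let $Q_i\in\mathbb R^{n_i\times n_i}$ and $P\in\mathbb R^{q\times q}$ be symmetric positive semidefinite, and let $\alpha>0$, $\beta\in(0,2)$, $\varepsilon_0>1$. Write $\mathbf A\mathbf x=\sum_iA_ix_i$, $\|w\|_M^2=w^TMw$, let $\|\cdot\|$ be the Euclidean norm of (products of) vectors and the spectral norm of matrices, and put $$\mathcal L^\alpha(\mathbf x,y,z)=\sum_{i=1}^pf_i(x_i)+h(y)+\langle z,\mathbf A\mathbf x+By+b\rangle+\tfrac\alpha2\|\mathbf A\mathbf x+By+b\|^2 .$$ Let $u^k=(\mathbf x^k,y^k,z^k)$, $k\ge0$, be generated by the proximal ADMM $$x_i^{k+1}\in\arg\min_{w}\ \mathcal L^\alpha(x_{<i}^{k+1},w,x_{>i}^k,y^k,z^k)+\tfrac12\|w-x_i^k\|_{Q_i}^2\quad(i=1,\dots,p),$$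 $$y^{k+1}\in\arg\min_{w}\ \mathcal L^\alpha(\mathbf x^{k+1},w,z^k)+\tfrac12\|w-y^k\|_P^2,\qquad z^{k+1}=z^k+\alpha\beta(\mathbf A\mathbf x^{k+1}+By^{k+1}+b),$$ where the minimal values are finite. Assume: * **A1.** each $f_i$ is lower semicontinuous and coercive ($f_i(w)\to+\infty$ as $\|w\|\to\infty$); * **A2.** $h$ is bounded from below and differentiable, and $\|\nabla h(v)-\nabla h(u)\|\le L_h\|v-u\|$ for all $u,v$; * **A3.** $\operatorname{Im}\mathbf A\subseteq\operatorname{Im}B$ and $b\in\operatorname{Im}B$; * **A4.** for each $i$, (i) $Q_i\succeq q_iI$ for some $q_i>0$, or (ii) there is $\varepsilon_i>0$ with $f_i(v)-f_i(w)-\langle s,v-w\rangle\ge-\frac{\varepsilon_i}2\|v-w\|^2$ for all $v,w$ and all $s\in\partial f_i(w)$ ($\partial$ denotes the limiting subdifferential). Let $\tau_i=q_i$ if (i) is used for block $i$ and $\tau_i=\lambda_{\min}(\alpha A_i^TA_i-\varepsilon_iI)$ if (ii) is used (either value, in particular the larger one, is allowed if both hold). Let $\lambda$ be the smallest positive eigenvalue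 of $B^TB$, $\rho(\beta)=1-|1-\beta|$, $$c_1=\tfrac1{\alpha\rho(\beta)\lambda},\quad c_2=\tfrac{2\beta}{\alpha\rho(\beta)^2\lambda},\quad c_3=c_2\|P\|^2,\quad c_4=c_2(\|P\|+L_h)^2,\quad c_5=\beta^{-1}|1-\beta|c_1,$$ $$\bar D=2P+\alpha B^TB-L_hI-2\varepsilon_0(c_3+c_4)I,\qquad \sigma=\min\Big\{\tfrac12\lambda_{\min}(\bar D),\ \tfrac12\min_i\tau_i,\ \tfrac{\varepsilon_0-1}{\alpha\beta}\Big\},$$ $$\tilde\rho=\max\Big\{\sum_i\|Q_i\|+\alpha a^2,\ \|P\|+\alpha a\|B\|+4\varepsilon_0c_3,\ a+\|B\|+4\varepsilon_0c_5\|B\|^2+\tfrac1{\alpha\beta}\Big\},\qquad a=\sum_i\|A_i\| ,$$ $$\bar{\mathcal L}(\mathbf x,y,z,y',z')=\mathcal L^\alpha(\mathbf x,y,z)+\varepsilon_0c_5\|B^T(z-z')\|^2+\varepsilon_0c_3\|y-y'\|^2 .$$ Let $u^*=(\mathbf x^*,y^*,z^*)$ be a limit point of $(u^k)$, $v^*=(\mathbf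 x^*,y^*,z^*,y^*,z^*)$, $\bar{\mathcal L}_k=\bar{\mathcal L}(\mathbf x^k,y^k,z^k,y^{k-1},z^{k-1})$ and $e_k=\bar{\mathcal L}_k-\bar{\mathcal L}(v^*)$ for $k\ge1$. Suppose that $\bar{\mathcal L}$ has the Kurdyka–Łojasiewicz property at $v^*$ with $\psi\in\Psi_\eta$, $0<\eta<\infty$: $\psi:[0,\eta)\to[0,\infty)$ is continuous and concave, $\psi(0)=0$, $\psi$ is $C^1$ with $\psi'>0$ on $(0,\eta)$, $\partial\bar{\mathcal L}(v^*)\neq\emptyset$, and $\psi'(\bar{\mathcal L}(v)-\bar{\mathcal L}(v^*))\,\mathrm{dist}(0,\partial\bar{\mathcal L}(v))\ge1$ for all $v$ in a neighbourhood of $v^*$ with $\bar{\mathcal L}(v^*)<\bar{\mathcal L}(v)<\bar{\mathcal L}(v^*)+\eta$. **Theorem 3.** If A1–A4 hold and $\sigma>0$, then $u^k\to u^*$, $\bar{\mathcal L}_k\to\bar{\mathcal L}(v^*)$, and there are $k_0\ge2$ and $c>0$ such that for all $k\ge k_0$: $0\le e_{k-1}<\eta$ and $$\|u^k-u^*\|\le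 c\max\{\psi(e_{k-1}),\sqrt{e_{k-1}}\}.$$ Moreover, if $\psi(s)=s^{1-\theta}$ on $[0,\eta)$ with $\theta\in[0,1)$, then: * (i) if $\theta=0$, then $u^k=u^*$ for all sufficiently large $k$; * (ii) if $\theta\in(0,\frac12]$, then for some constant $C>0$ and all $k\ge k_0$ $$\|u^k-u^*\|\le C\sqrt{e_{k_0}}\Big/\Big(\sqrt{1+\bar\alpha e_{k_0}^{2\theta-1}}\Big)^{k-k_0},\qquad \bar\alpha=\frac{\sigma}{(p+2)(1-\theta)^2\tilde\rho^2}$$ (the right-hand side is read as $0$ if $e_{k_0}=0$); in particular $\|u^k-u^*\|\le C'r^k$ for $k\ge k_0$, with some $C'>0$ and $r\in(0,1)$; * (iii) if $\theta\in(\frac12,1)$, then for some constants $C,\mu>0$ and all $k\ge k_0$ $$\|u^k-u^*\|\le C\big(\mu(k-k_0)+\mu+e_{k_0-1}^{1-2\theta}\big)^{-\frac{1-\theta}{2\theta-1}}$$ (if $e_{k_0-1}=0$, the term $e_{k_0-1}^{1-2\theta}$ is read as $0$; in that case $u^k=u^*$ for all $k\ge k_0$); in particular $\|u^k-u^*\|=O\big(k^{-(1-\theta)/(2\theta-1)}\big)$.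 -/

import Mathlib

noncomputable section

namespace PADMM

/-! ### Variational analysis -/

section Variational

variable {E : Type*} [NormedAddCommGroup E] [InnerProductSpace ℝ E]

/-- `Φ` takes values in `ℝ ∪ {+∞}` and is not identically `+∞`. -/
def Proper (Φ : E → EReal) : Prop :=
  (∀ x, Φ x ≠ ⊥) ∧ ∃ x, Φ x ≠ ⊤

/-- The set of minimizers. A function that is identically `+∞` has none. -/
def argmin {α : Type*} (Φ : α → EReal) : Set α :=
  {x | Φ x < ⊤ ∧ ∀ w, Φ x ≤ Φ w}

/-- The Fréchet subdifferential: `s` belongs to it when `x ∈ dom Φ` and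
`liminf (Φ y - Φ x - ⟨s, y - x⟩) / ‖y - x‖ ≥ 0` as `y → x`, `y ≠ x`. -/
def frechetSubdiff (Φ : E → EReal) (x : E) : Set E :=
  {s | Φ x < ⊤ ∧ ∀ ε : ℝ, 0 < ε →
    ∀ᶠ y in nhds x, Φ x + ((inner ℝ s (y - x) - ε * ‖y - x‖ : ℝ) : EReal) ≤ Φ y}

/-- The limiting (Mordukhovich) subdifferential. -/
def limitingSubdiff (Φ : E → EReal) (x : E) : Set E :=
  {s | Φ x < ⊤ ∧ ∃ (ξ : ℕ → E) (ς : ℕ → E),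
    Filter.Tendsto ξ Filter.atTop (nhds x) ∧
    Filter.Tendsto (fun j => Φ (ξ j)) Filter.atTop (nhds (Φ x)) ∧
    (∀ j, ς j ∈ frechetSubdiff Φ (ξ j)) ∧
    Filter.Tendsto ς Filter.atTop (nhds s)}

/-- The class `Ψ_η` of desingularizing functions on `[0, η)`. -/
structure Desingularizing (η : ℝ) (ψ : ℝ → ℝ) : Prop where
  eta_pos : 0 < η
  continuousOn : ContinuousOn ψ (Set.Ico 0 η)
  concaveOn : ConcaveOn ℝ (Set.Ico 0 η) ψ
  nonneg : ∀ s ∈ Set.Ico 0 η, 0 ≤ ψ s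
  zero : ψ 0 = 0
  contDiffOn : ContDiffOn ℝ 1 ψ (Set.Ioo 0 η)
  deriv_pos : ∀ s ∈ Set.Ioo 0 η, 0 < deriv ψ s

/-- `Φ` has the Kurdyka–Łojasiewicz property at `xs ∈ dom ∂Φ` with the function `ψ ∈ Ψ_η`:
`ψ'(Φ x - Φ xs) · dist(0, ∂Φ x) ≥ 1` for all `x` in a neighbourhood of `xs` with
`Φ xs < Φ x < Φ xs + η`. The distance to the empty set is `+∞`. -/
def HasKLWith (Φ : E → EReal) (xs : E) (η : ℝ) (ψ : ℝ → ℝ) : Prop :=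
  (limitingSubdiff Φ xs).Nonempty ∧ Desingularizing η ψ ∧
    ∀ᶠ x in nhds xs, Φ xs < Φ x → Φ x < Φ xs + (η : EReal) →
      1 ≤ ENNReal.ofReal (deriv ψ ((Φ x).toReal - (Φ xs).toReal)) *
        Metric.infEDist 0 (limitingSubdiff Φ x)

/-- `f v ≥ f w + ⟨s, v - w⟩ - (ε / 2) ‖v - w‖²` for all `v`, `w` and all `s ∈ ∂f w`. -/
def WeaklyConvex (f : E → EReal) (ε : ℝ) : Prop :=
  ∀ v w s : E, s ∈ limitingSubdiff f w →
    f w + ((inner ℝ s (v - w) - ε / 2 * ‖v - w‖ ^ 2 : ℝ) : EReal) ≤ f v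

/-- The smallest eigenvalue (of a self-adjoint operator). -/
def lamMin (T : E →L[ℝ] E) : ℝ :=
  sInf {l : ℝ | Module.End.HasEigenvalue (T : E →ₗ[ℝ] E) l}

/-- The smallest strictly positive eigenvalue (of a self-adjoint operator). -/
def lamPos (T : E →L[ℝ] E) : ℝ :=
  sInf {l : ℝ | 0 < l ∧ Module.End.HasEigenvalue (T : E →ₗ[ℝ] E) l}

end Variational

/-! ### The problem and the algorithm -/

/-- `ℝᵈ` with the Euclidean norm. -/
abbrev Eu (d : ℕ) := EuclideanSpace ℝ (Fin d)

/-- `ℝ^{n₁} × ⋯ × ℝ^{n_p}` with the Euclidean norm. -/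
abbrev Blocks {p : ℕ} (n : Fin p → ℕ) := PiLp 2 (fun i => Eu (n i))

/-- The triples `u = (x, y, z)` with the Euclidean product norm. -/
abbrev Triple {p : ℕ} (n : Fin p → ℕ) (q m : ℕ) :=
  WithLp 2 (Blocks n × WithLp 2 (Eu q × Eu m))

/-- The quintuples `v = (x, y, z, y', z')` with the Euclidean product norm. -/
abbrev Quintuple {p : ℕ} (n : Fin p → ℕ) (q m : ℕ) :=
  WithLp 2 (Blocks n × WithLp 2 (Eu q × WithLp 2 (Eu m × WithLp 2 (Eu q × Eu m))))

/-- The triple `(x, y, z)`. -/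
def triple {p : ℕ} {n : Fin p → ℕ} {q m : ℕ} (x : Blocks n) (y : Eu q) (z : Eu m) :
    Triple n q m :=
  WithLp.toLp 2 (x, WithLp.toLp 2 (y, z))

/-- The quintuple `(x, y, z, y', z')`. -/
def quintuple {p : ℕ} {n : Fin p → ℕ} {q m : ℕ} (x : Blocks n) (y : Eu q) (z : Eu m)
    (y' : Eu q) (z' : Eu m) : Quintuple n q m :=
  WithLp.toLp 2 (x, WithLp.toLp 2 (y, WithLp.toLp 2 (z, WithLp.toLp 2 (y', z'))))

/-- The data: the objective functions, the constraint `∑ A i (x i) + B y + b = 0`, the proximal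
matrices, the parameters `α`, `β`, the Lipschitz constant `Lh` of `∇h`, and the auxiliary
parameter `ε₀`. Matrices are written as linear maps; their norm is the spectral norm. -/
structure Data {p : ℕ} (n : Fin p → ℕ) (q m : ℕ) where
  f : ∀ i, Eu (n i) → EReal
  h : Eu q → ℝ
  A : ∀ i, Eu (n i) →L[ℝ] Eu m
  B : Eu q →L[ℝ] Eu m
  b : Eu m
  Q : ∀ i, Eu (n i) →L[ℝ] Eu (n i)
  P : Eu q →L[ℝ] Eu q
  α : ℝ
  β : ℝ
  Lh : ℝ
  ε₀ : ℝ

namespace Data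

variable {p : ℕ} {n : Fin p → ℕ} {q m : ℕ} (D : Data n q m)

/-- The constraint residual `∑ A i (x i) + B y + b`. -/
def residual (x : Blocks n) (y : Eu q) : Eu m :=
  ∑ i, D.A i (x i) + D.B y + D.b

/-- The augmented Lagrangian. -/
def augL (x : Blocks n) (y : Eu q) (z : Eu m) : EReal :=
  ∑ i, D.f i (x i) +
    ((D.h y + inner ℝ z (D.residual x y) + D.α / 2 * ‖D.residual x y‖ ^ 2 : ℝ) : EReal)

/-- The point `(xnew_{<i}, w, xold_{>i})`. -/
def sweep (xnew xold : Blocks n) (i : Fin p) (w : Eu (n i)) : Blocks n :=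
  WithLp.toLp 2 (Function.update (fun j => if j < i then xnew j else xold j) i w)

/-- `(x k, y k, z k)` is generated by the proximal ADMM. -/
structure IsIteration (x : ℕ → Blocks n) (y : ℕ → Eu q) (z : ℕ → Eu m) : Prop where
  x_step : ∀ k i, x (k + 1) i ∈ argmin (fun w : Eu (n i) =>
    D.augL (sweep (x (k + 1)) (x k) i w) (y k) (z k) +
      ((1 / 2 * inner ℝ (w - x k i) (D.Q i (w - x k i)) : ℝ) : EReal))
  y_step : ∀ k, y (k + 1) ∈ argmin (fun w : Eu q =>
    D.augL (x (k + 1)) w (z k) +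
      ((1 / 2 * inner ℝ (w - y k) (D.P (w - y k)) : ℝ) : EReal))
  z_step : ∀ k, z (k + 1) = z k + (D.α * D.β) • D.residual (x (k + 1)) (y (k + 1))

/-- The standing requirements on the parameters, the proximal matrices and `B`. -/
structure Standing : Prop where
  p_pos : 0 < p
  α_pos : 0 < D.α
  β_pos : 0 < D.β
  β_lt_two : D.β < 2
  ε₀_gt_one : 1 < D.ε₀
  Q_pos : ∀ i, (D.Q i).IsPositive
  P_pos : D.P.IsPositive
  B_ne_zero : D.B ≠ 0

/-- Each `f i` is proper, lower semicontinuous and coercive. -/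
structure A1 : Prop where
  proper : ∀ i, Proper (D.f i)
  lsc : ∀ i, LowerSemicontinuous (D.f i)
  coercive : ∀ i, Filter.Tendsto (D.f i) (Bornology.cobounded (Eu (n i))) (nhds ⊤)

/-- `h` is bounded from below and differentiable with an `Lh`-Lipschitz gradient. -/
structure A2 : Prop where
  bddBelow : BddBelow (Set.range D.h)
  differentiable : Differentiable ℝ D.h
  lipschitz : ∀ u v : Eu q, ‖gradient D.h v - gradient D.h u‖ ≤ D.Lh * ‖v - u‖

/-- `Im A ⊆ Im B` and `b ∈ Im B`. -/
structure A3 : Prop where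
  im_A : ∀ x : Blocks n, ∑ i, D.A i (x i) ∈ Set.range D.B
  b_mem : D.b ∈ Set.range D.B

/-- `αAᵢᵀAᵢ - εI`. -/
def weakMatrix (i : Fin p) (ε : ℝ) : Eu (n i) →L[ℝ] Eu (n i) :=
  D.α • ((D.A i).adjoint ∘L D.A i) - ε • ContinuousLinearMap.id ℝ (Eu (n i))

/-- `τ` is a modulus for block `i`: either `τ > 0` and `Qᵢ ⪰ τ I`, or `f i` is weakly convex with
some constant `ε > 0` and `τ` is the smallest eigenvalue of `αAᵢᵀAᵢ - εI`. Where both alternatives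
are available, the larger of the two values is in particular a modulus. -/
def IsModulus (i : Fin p) (τ : ℝ) : Prop :=
  (0 < τ ∧ ∀ w : Eu (n i), τ * ‖w‖ ^ 2 ≤ inner ℝ w (D.Q i w)) ∨
    ∃ ε : ℝ, 0 < ε ∧ WeaklyConvex (D.f i) ε ∧ τ = lamMin (D.weakMatrix i ε)

/-! ### The constants -/

/-- The smallest positive eigenvalue of `BᵀB`. -/
def lamB : ℝ := lamPos (D.B.adjoint ∘L D.B)

/-- `ρ(β) = 1 - |1 - β|`. -/
def rhoBeta : ℝ := 1 - |1 - D.β|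

/-- The constant `c₁`. -/
def c₁ : ℝ := 1 / (D.α * D.rhoBeta * D.lamB)

/-- The constant `c₂`. -/
def c₂ : ℝ := 2 * D.β / (D.α * D.rhoBeta ^ 2 * D.lamB)

/-- The constant `c₃`. -/
def c₃ : ℝ := D.c₂ * ‖D.P‖ ^ 2

/-- The constant `c₄`. -/
def c₄ : ℝ := D.c₂ * (‖D.P‖ + D.Lh) ^ 2

/-- The constant `c₅`. -/
def c₅ : ℝ := D.β⁻¹ * |1 - D.β| * D.c₁

/-- `2P + αBᵀB - Lh I - 2ε₀(c₃ + c₄) I`. -/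
def Dbar : Eu q →L[ℝ] Eu q :=
  (2 : ℝ) • D.P + D.α • (D.B.adjoint ∘L D.B) - D.Lh • ContinuousLinearMap.id ℝ (Eu q)
    - (2 * D.ε₀ * (D.c₃ + D.c₄)) • ContinuousLinearMap.id ℝ (Eu q)

/-- The descent constant `σ`, for given block moduli `τ`. -/
def sigma (τ : Fin p → ℝ) : ℝ :=
  min (lamMin D.Dbar / 2) (min ((⨅ i, τ i) / 2) ((D.ε₀ - 1) / (D.α * D.β)))

/-- The subgradient constant `ρ̃`. -/
def rhoTilde : ℝ :=
  max (∑ i, ‖D.Q i‖ + D.α * (∑ i, ‖D.A i‖) ^ 2)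
    (max (‖D.P‖ + D.α * (∑ i, ‖D.A i‖) * ‖D.B‖ + 4 * D.ε₀ * D.c₃)
      (∑ i, ‖D.A i‖ + ‖D.B‖ + 4 * D.ε₀ * D.c₅ * ‖D.B‖ ^ 2 + 1 / (D.α * D.β)))

/-- `ᾱ = σ / ((p + 2) (1 - θ)² ρ̃²)`. -/
def alphaBar (τ : Fin p → ℝ) (θ : ℝ) : ℝ :=
  D.sigma τ / (((p : ℝ) + 2) * (1 - θ) ^ 2 * D.rhoTilde ^ 2)

/-! ### The modified augmented Lagrangian and the errors -/

/-- The modified augmented Lagrangian `L̄(x, y, z, y', z')`. -/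
def Lbar (v : Quintuple n q m) : EReal :=
  D.augL v.fst v.snd.fst v.snd.snd.fst +
    ((D.ε₀ * D.c₅ * ‖D.B.adjoint (v.snd.snd.fst - v.snd.snd.snd.snd)‖ ^ 2 +
      D.ε₀ * D.c₃ * ‖v.snd.fst - v.snd.snd.snd.fst‖ ^ 2 : ℝ) : EReal)

/-- `L̄_k = L̄(x k, y k, z k, y (k - 1), z (k - 1))`, meaningful for `k ≥ 1`. -/
def LbarSeq (x : ℕ → Blocks n) (y : ℕ → Eu q) (z : ℕ → Eu m) (k : ℕ) : EReal :=
  D.Lbar (quintuple (x k) (y k) (z k) (y (k - 1)) (z (k - 1)))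

/-- `e_k = L̄_k - L̄(x*, y*, z*, y*, z*)`, for `k ≥ 1`. -/
def err (x : ℕ → Blocks n) (y : ℕ → Eu q) (z : ℕ → Eu m)
    (xs : Blocks n) (ys : Eu q) (zs : Eu m) (k : ℕ) : ℝ :=
  (D.LbarSeq x y z k).toReal - (D.Lbar (quintuple xs ys zs ys zs)).toReal

end Data

end PADMM

end

/-! The proof applies the Kurdyka–Łojasiewicz (KL) method to the modified Lagrangian L̄. It rests on
three facts about consecutive iterates; Δ denotes the change over one iteration.

Sufficient decrease (`descent`). The x-sweep and the y-step lower the augmented Lagrangian, while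
the multiplier step raises it by ‖Δz‖²/(αβ). By A3, Δz lies in Im B, so BᵀΔz controls it.
Subtracting consecutive optimality conditions of the y-step gives a recursion for BᵀΔz with factor
|1-β| < 1, driven by the increments of ∇h(y) and of PΔy (`dual_bound`). The two extra terms of L̄
make the contributions of the previous step telescope, and at least σ‖Δu‖² of decrease is left.

Relative error (`LbarSubgrad_mem`, `norm_LbarSubgrad_le`). Optimality in the subproblems yields an
explicit subgradient of L̄ at the new point whose norm is at most a constant times ‖Δu‖.

Continuity of values (`LbarR_tendsto`). The fᵢ are only lower semicontinuous, but the optimality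
inequality of each block step, tested at the limit point, supplies the opposite estimate.

Concavity of ψ then gives a telescoping bound on the steps (`kl_step`, `kl_tail`). Once an iterate
is near u* with a small enough value, all later ones stay in the KL neighbourhood and converge
(`kl_convergence`). For ψ(s) = s^(1-θ) the same facts become the scalar recurrence E(j+1) + a
E(j+1)^(2θ) ≤ E(j) (`kl_recurrence`), whose solutions vanish, decay geometrically or decay
polynomially according to θ. -/

noncomputable section

namespace PADMM

/-! ### Spectral bounds for symmetric operators -/

section Spectral

variable {E : Type*} [NormedAddCommGroup E] [InnerProductSpace ℝ E] [FiniteDimensional ℝ E]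

theorem inner_map_self_eq_sum {T : E →L[ℝ] E} (hT : (T : E →ₗ[ℝ] E).IsSymmetric) (v : E) :
    inner ℝ v (T v) = ∑ i, hT.eigenvalues rfl i * (hT.eigenvectorBasis rfl).repr v i ^ 2 := by
  rw [← (hT.eigenvectorBasis rfl).sum_inner_mul_inner]
  refine Finset.sum_congr rfl fun i _ => ?_
  have h1 := hT.eigenvectorBasis_apply_self_apply rfl v i
  rw [(hT.eigenvectorBasis rfl).repr_apply_apply] at h1
  rw [real_inner_comm, ← (hT.eigenvectorBasis rfl).repr_apply_apply]
  have h2 : inner ℝ ((hT.eigenvectorBasis rfl) i) (T v) =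
    hT.eigenvalues rfl i * (hT.eigenvectorBasis rfl).repr v i := h1
  rw [h2]; ring

theorem norm_map_sq_eq_sum {T : E →L[ℝ] E} (hT : (T : E →ₗ[ℝ] E).IsSymmetric) (v : E) :
    ‖T v‖ ^ 2 = ∑ i, hT.eigenvalues rfl i ^ 2 * (hT.eigenvectorBasis rfl).repr v i ^ 2 := by
  rw [← (hT.eigenvectorBasis rfl).sum_sq_norm_inner_right]
  refine Finset.sum_congr rfl fun i _ => ?_
  have h1 := hT.eigenvectorBasis_apply_self_apply rfl v i
  rw [(hT.eigenvectorBasis rfl).repr_apply_apply] at h1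
  have h2 : inner ℝ ((hT.eigenvectorBasis rfl) i) (T v) =
    hT.eigenvalues rfl i * (hT.eigenvectorBasis rfl).repr v i := h1
  rw [h2, Real.norm_eq_abs, sq_abs]; ring

theorem norm_sq_eq_sum_repr {T : E →L[ℝ] E} (hT : (T : E →ₗ[ℝ] E).IsSymmetric) (v : E) :
    ‖v‖ ^ 2 = ∑ i, (hT.eigenvectorBasis rfl).repr v i ^ 2 := by
  rw [← (hT.eigenvectorBasis rfl).sum_sq_norm_inner_right]
  refine Finset.sum_congr rfl fun i _ => ?_
  rw [(hT.eigenvectorBasis rfl).repr_apply_apply, Real.norm_eq_abs, sq_abs]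

theorem finite_eigenvalue_set (T : E →L[ℝ] E) :
    {l : ℝ | Module.End.HasEigenvalue (T : E →ₗ[ℝ] E) l}.Finite :=
  Module.End.finite_hasEigenvalue (T : E →ₗ[ℝ] E)

theorem lamMin_mul_norm_sq_le {T : E →L[ℝ] E} (hT : (T : E →ₗ[ℝ] E).IsSymmetric) (v : E) :
    lamMin T * ‖v‖ ^ 2 ≤ inner ℝ v (T v) := by
  rw [inner_map_self_eq_sum hT, norm_sq_eq_sum_repr hT, Finset.mul_sum]
  refine Finset.sum_le_sum fun i _ => ?_
  gcongr
  exact csInf_le (finite_eigenvalue_set T).bddBelow (hT.hasEigenvalue_eigenvalues rfl i)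

/-- For a positive operator `T`, the smallest positive eigenvalue controls `⟨v, T v⟩`. -/
theorem lamPos_mul_inner_le {T : E →L[ℝ] E} (hT : (T : E →ₗ[ℝ] E).IsSymmetric)
    (hpos : ∀ v, 0 ≤ inner ℝ v (T v)) (v : E) :
    lamPos T * inner ℝ v (T v) ≤ ‖T v‖ ^ 2 := by
  rw [inner_map_self_eq_sum hT, norm_map_sq_eq_sum hT, Finset.mul_sum]
  refine Finset.sum_le_sum fun i _ => ?_
  have hev := hT.hasEigenvalue_eigenvalues rfl i
  have h0 : 0 ≤ hT.eigenvalues rfl i := by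
    have h := hpos (hT.eigenvectorBasis rfl i)
    have h1 : T (hT.eigenvectorBasis rfl i) = hT.eigenvalues rfl i • hT.eigenvectorBasis rfl i :=
      hT.apply_eigenvectorBasis rfl i
    rw [h1, inner_smul_right, real_inner_self_eq_norm_sq,
      (hT.eigenvectorBasis rfl).orthonormal.1 i] at h
    simpa using h
  -- A zero eigenvalue contributes to neither side; every other one is at least `lamPos T`.
  rcases h0.eq_or_lt with h | h
  · rw [← h]; simp
  · have : lamPos T ≤ hT.eigenvalues rfl i :=
      csInf_le ((finite_eigenvalue_set T).subset fun l hl => hl.2).bddBelow ⟨h, hev⟩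
    rw [← mul_assoc]
    gcongr
    rw [pow_two]
    gcongr

/-- A positive value of the quadratic form forces a positive eigenvalue, and the infimum of a
nonempty finite set is attained; an empty set would give the default value 0. -/
theorem lamPos_pos {T : E →L[ℝ] E} (hT : (T : E →ₗ[ℝ] E).IsSymmetric)
    (hex : ∃ v, 0 < inner ℝ v (T v)) : 0 < lamPos T := by
  obtain ⟨v, hv⟩ := hex
  rw [inner_map_self_eq_sum hT] at hv
  obtain ⟨i, -, hi⟩ := Finset.exists_lt_of_sum_lt (s := Finset.univ) (f := fun _ => (0 : ℝ))
    (by simpa using hv)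
  have hi' : 0 < hT.eigenvalues rfl i := pos_of_mul_pos_left hi (sq_nonneg _)
  have hmem := Set.Nonempty.csInf_mem (s := {l : ℝ | 0 < l ∧
    Module.End.HasEigenvalue (T : E →ₗ[ℝ] E) l})
    ⟨_, hi', hT.hasEigenvalue_eigenvalues rfl i⟩
    ((finite_eigenvalue_set T).subset fun l hl => hl.2)
  exact hmem.1

end Spectral

/-! ### Descent lemma, telescoping identity, extended-real arithmetic, first-order condition -/

section Helpers

/-- The descent lemma for a function with a Lipschitz gradient. -/
theorem gradient_lower_bound {E : Type*} [NormedAddCommGroup E] [InnerProductSpace ℝ E]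
    [CompleteSpace E] {h : E → ℝ} {L : ℝ} (hd : Differentiable ℝ h)
    (hL : ∀ u v : E, ‖gradient h v - gradient h u‖ ≤ L * ‖v - u‖) (u v : E) :
    h u + inner ℝ (gradient h u) (v - u) - L / 2 * ‖v - u‖ ^ 2 ≤ h v := by
  set d := v - u with hdd
  -- The quadratic term compensates the variation of the gradient, so φ is monotone on [0, 1]; the
  -- claim is φ 0 ≤ φ 1.
  let φ : ℝ → ℝ := fun t => h (u + t • d) - t * inner ℝ (gradient h u) d + L / 2 * ‖d‖ ^ 2 * t ^ 2
  have hφ : ∀ t, HasDerivAt φ (inner ℝ (gradient h (u + t • d)) d - inner ℝ (gradient h u) d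
      + L * ‖d‖ ^ 2 * t) t := by
    intro t
    have h1 : HasDerivAt (fun t : ℝ => u + t • d) d t := by
      simpa using ((hasDerivAt_id t).smul_const d).const_add u
    have h2 := ((hd (u + t • d)).hasGradientAt.hasFDerivAt).comp_hasDerivAt t h1
    have h3 : HasDerivAt (fun t : ℝ => t * inner ℝ (gradient h u) d)
        (inner ℝ (gradient h u) d) t := by
      simpa using (hasDerivAt_id t).mul_const (inner ℝ (gradient h u) d)
    have h4 : HasDerivAt (fun t : ℝ => L / 2 * ‖d‖ ^ 2 * t ^ 2) (L / 2 * ‖d‖ ^ 2 * (2 * t)) t := by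
      simpa using (hasDerivAt_pow 2 t).const_mul (L / 2 * ‖d‖ ^ 2)
    rw [InnerProductSpace.toDual_apply_apply] at h2
    have h5 : HasDerivAt φ _ t := (h2.sub h3).add h4
    refine h5.congr_deriv ?_
    ring
  have hmono : MonotoneOn φ (Set.Icc 0 1) := by
    refine monotoneOn_of_deriv_nonneg (convex_Icc 0 1)
      (fun t _ => (hφ t).continuousAt.continuousWithinAt)
      (fun t _ => (hφ t).differentiableAt.differentiableWithinAt) fun t ht => ?_
    rw [interior_Icc] at ht
    rw [(hφ t).deriv, ← inner_sub_left]
    have h1 := hL u (u + t • d)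
    have h2 := abs_le.mp (abs_real_inner_le_norm (gradient h (u + t • d) - gradient h u) d)
    rw [add_sub_cancel_left, norm_smul, Real.norm_eq_abs, abs_of_pos ht.1] at h1
    have h3 := mul_le_mul_of_nonneg_right h1 (norm_nonneg d)
    nlinarith [h2.1]
  have h01 := hmono (Set.left_mem_Icc.2 zero_le_one) (Set.right_mem_Icc.2 zero_le_one) zero_le_one
  simp only [φ, zero_smul, add_zero, one_smul, zero_mul, one_mul, one_pow, sub_zero, mul_one] at h01
  have : u + d = v := by rw [hdd]; abel
  rw [this] at h01
  simp only [ne_eq, OfNat.ofNat_ne_zero, not_false_eq_true, zero_pow, mul_zero, add_zero] at h01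
  linarith

/-- With S_i = r + ∑_{j ≤ i} a_j, each summand equals ‖S_i‖² - ‖S_{i-1}‖², so the sum telescopes.
This is the accounting of a Gauss–Seidel sweep, where block i sees the residual after blocks j ≤ i
have moved. -/
theorem sum_partial_inner {V : Type*} [NormedAddCommGroup V] [InnerProductSpace ℝ V] :
    ∀ {p : ℕ} (a : Fin p → V) (r : V),
      ∑ i, (2 * inner ℝ (r + ∑ j, if j ≤ i then a j else 0) (a i) - ‖a i‖ ^ 2) =
        ‖r + ∑ i, a i‖ ^ 2 - ‖r‖ ^ 2
  | 0, a, r => by simp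
  | p + 1, a, r => by
    have ih := sum_partial_inner (fun i : Fin p => a i.castSucc) r
    rw [Fin.sum_univ_castSucc]
    have h1 : ∀ i : Fin p, (∑ j, if j ≤ i.castSucc then a j else 0) =
        ∑ j : Fin p, if j ≤ i then a j.castSucc else 0 := by
      intro i
      rw [Fin.sum_univ_castSucc]
      simp [Fin.not_le.2 (Fin.castSucc_lt_last i)]
    have h2 : (∑ j, if j ≤ Fin.last p then a j else 0) = ∑ j, a j :=
      Finset.sum_congr rfl fun j _ => if_pos (Fin.le_last j)
    simp only [h1, h2, ih]
    rw [Fin.sum_univ_castSucc (f := a)]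
    set S := ∑ i : Fin p, a i.castSucc
    set c := a (Fin.last p)
    rw [← add_assoc, @norm_add_sq_real _ _ _ (r + S) c, inner_add_left, real_inner_self_eq_norm_sq]
    ring

theorem ereal_sum_ne_bot {ι : Type*} (s : Finset ι) {g : ι → EReal} (h : ∀ i ∈ s, g i ≠ ⊥) :
    ∑ i ∈ s, g i ≠ ⊥ := by
  classical
  induction s using Finset.induction_on with
  | empty => simp
  | insert a s ha ih =>
    rw [Finset.sum_insert ha]
    simp only [Finset.mem_insert, forall_eq_or_imp] at h
    exact EReal.add_ne_bot_iff.2 ⟨h.1, ih h.2⟩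

theorem ereal_ne_top_of_sum_ne_top {ι : Type*} (s : Finset ι) {g : ι → EReal}
    (h : ∀ i ∈ s, g i ≠ ⊥) (hs : ∑ i ∈ s, g i ≠ ⊤) : ∀ i ∈ s, g i ≠ ⊤ := by
  classical
  intro i hi hg
  apply hs
  rw [← Finset.add_sum_erase s g hi, hg]
  exact EReal.top_add_of_ne_bot
    (ereal_sum_ne_bot _ fun j hj => h j (Finset.mem_of_mem_erase hj))

theorem ereal_coe_sum {ι : Type*} (s : Finset ι) (g : ι → ℝ) :
    ((∑ i ∈ s, g i : ℝ) : EReal) = ∑ i ∈ s, (g i : EReal) := by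
  classical
  induction s using Finset.induction_on with
  | empty => simp
  | insert a s ha ih => rw [Finset.sum_insert ha, Finset.sum_insert ha, EReal.coe_add, ih]

theorem ereal_sum_eq_coe {ι : Type*} (s : Finset ι) {g : ι → EReal}
    (h : ∀ i ∈ s, g i ≠ ⊥) (h' : ∀ i ∈ s, g i ≠ ⊤) :
    ∑ i ∈ s, g i = ((∑ i ∈ s, (g i).toReal : ℝ) : EReal) := by
  rw [ereal_coe_sum]
  exact Finset.sum_congr rfl fun i hi => (EReal.coe_toReal (h' i hi) (h i hi)).symm

end Helpers

/-- Here `c` stands for the objectives of the blocks held fixed. Finiteness of the left side makes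
`a` and `c` real, so `c` can be cancelled even when `b` is infinite. -/
theorem ereal_cancel {a b c : EReal} {r s : ℝ} (ha : a ≠ ⊥) (hb : b ≠ ⊥) (hc : c ≠ ⊥)
    (hlt : a + c + (r : EReal) < ⊤) (h : a + c + (r : EReal) ≤ b + c + (s : EReal)) :
    a ≠ ⊤ ∧ a + ((r - s : ℝ) : EReal) ≤ b := by
  have hac : a ≠ ⊤ ∧ c ≠ ⊤ := by
    constructor
    · rintro rfl
      rw [EReal.top_add_of_ne_bot hc, EReal.top_add_coe] at hlt
      exact lt_irrefl _ hlt
    · rintro rfl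
      rw [EReal.add_top_of_ne_bot ha, EReal.top_add_coe] at hlt
      exact lt_irrefl _ hlt
  refine ⟨hac.1, ?_⟩
  lift a to ℝ using ⟨hac.1, ha⟩
  lift c to ℝ using ⟨hac.2, hc⟩
  induction b using EReal.rec with
  | bot => exact absurd rfl hb
  | top => exact le_top
  | coe b =>
    norm_cast at h ⊢
    linarith

/-- The quadratic term has zero derivative at `u`, so any constant `C` will do and second-order
terms may be estimated crudely. -/
theorem gradient_add_eq_zero_of_min {E : Type*} [NormedAddCommGroup E] [InnerProductSpace ℝ E]
    [CompleteSpace E] {h : E → ℝ} {u g : E} {C : ℝ} (hd : DifferentiableAt ℝ h u)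
    (hmin : ∀ w, h u ≤ h w + inner ℝ g (w - u) + C * ‖w - u‖ ^ 2) : gradient h u + g = 0 := by
  have h1 : HasFDerivAt h (InnerProductSpace.toDual ℝ E (gradient h u)) u :=
    hd.hasGradientAt.hasFDerivAt
  have h0 : HasFDerivAt (fun w : E => w - u) (ContinuousLinearMap.id ℝ E) u :=
    (hasFDerivAt_id u).sub_const u
  have h2 : HasFDerivAt (fun w : E => inner ℝ g (w - u)) (InnerProductSpace.toDual ℝ E g) u := by
    have := (InnerProductSpace.toDual ℝ E g).hasFDerivAt.comp u h0
    simpa [Function.comp_def] using this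
  have h3 : HasFDerivAt (fun w : E => C * ‖w - u‖ ^ 2) (0 : E →L[ℝ] ℝ) u := by
    have := (h0.norm_sq).const_mul C
    simpa using this
  have h4 := (h1.add h2).add h3
  have hm : IsLocalMin ((h + fun w : E => inner ℝ g (w - u)) + fun w => C * ‖w - u‖ ^ 2) u :=
    Filter.Eventually.of_forall fun w => by simpa using hmin w
  have h5 := hm.hasFDerivAt_eq_zero h4
  rw [add_zero, ← map_add] at h5
  exact (map_eq_zero_iff _ (InnerProductSpace.toDual ℝ E).injective).1 h5

theorem inner_add_norm_sq_expand {V : Type*} [NormedAddCommGroup V] [InnerProductSpace ℝ V]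
    (α : ℝ) (z R a : V) :
    inner ℝ z (R + a) + α / 2 * ‖R + a‖ ^ 2 =
      inner ℝ z R + α / 2 * ‖R‖ ^ 2 + inner ℝ (z + α • R) a + α / 2 * ‖a‖ ^ 2 := by
  rw [@norm_add_sq_real, inner_add_right, inner_add_left, inner_smul_left]
  simp
  ring

theorem inner_map_expand {V : Type*} [NormedAddCommGroup V] [InnerProductSpace ℝ V]
    {T : V →L[ℝ] V} (hT : (T : V →ₗ[ℝ] V).IsSymmetric) (a d : V) :
    inner ℝ (a + d) (T (a + d)) = inner ℝ a (T a) + 2 * inner ℝ (T a) d + inner ℝ d (T d) := by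
  have h : inner ℝ (T d) a = inner ℝ d (T a) := hT d a
  rw [map_add, inner_add_left, inner_add_right, inner_add_right, real_inner_comm d (T a), ←h,
    real_inner_comm a (T d)]
  ring

/-! ### Optimality and decrease in the x-sweep -/

namespace Data

variable {p : ℕ} {n : Fin p → ℕ} {q m : ℕ} {D : Data n q m}

theorem residual_eq_add (x x' : Blocks n) (y y' : Eu q) :
    D.residual x' y' = D.residual x y + ∑ i, D.A i (x' i - x i) + D.B (y' - y) := by
  simp only [residual, map_sub, Finset.sum_sub_distrib]
  abel

theorem residual_sweep (xn xo : Blocks n) (i : Fin p) (w w' : Eu (n i)) (y : Eu q) :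
    D.residual (sweep xn xo i w) y = D.residual (sweep xn xo i w') y + D.A i (w - w') := by
  rw [residual_eq_add (sweep xn xo i w') (sweep xn xo i w) y y, sub_self, map_zero, add_zero,
    Finset.sum_eq_single i]
  · simp [sweep]
  · intro j _ hj
    simp [sweep, Function.update_of_ne hj]
  · simp

/-- These residuals are exactly the partial sums in `sum_partial_inner`. -/
theorem residual_sweep_self (xn xo : Blocks n) (i : Fin p) (y : Eu q) :
    D.residual (sweep xn xo i (xn i)) y =
      D.residual xo y + ∑ j, if j ≤ i then D.A j (xn j - xo j) else 0 := by
  rw [residual_eq_add xo _ y y, sub_self, map_zero, add_zero]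
  congr 1
  refine Finset.sum_congr rfl fun j _ => ?_
  rcases lt_trichotomy j i with h | rfl | h
  · simp [sweep, Function.update_of_ne h.ne, h, h.le]
  · simp [sweep]
  · simp [sweep, Function.update_of_ne h.ne', h.not_gt, h.not_ge]

/-- The real-valued augmented Lagrangian, meaningful on the domain of `∑ f i`. -/
def augR (D : Data n q m) (x : Blocks n) (y : Eu q) (z : Eu m) : ℝ :=
  ∑ i, (D.f i (x i)).toReal +
    (D.h y + inner ℝ z (D.residual x y) + D.α / 2 * ‖D.residual x y‖ ^ 2)

theorem augL_eq_coe (h1 : D.A1) {x : Blocks n} (hx : ∀ i, D.f i (x i) ≠ ⊤) (y : Eu q)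
    (z : Eu m) : D.augL x y z = (D.augR x y z : EReal) := by
  rw [augL, augR, ereal_sum_eq_coe _ (fun i _ => (h1.proper i).1 _) (fun i _ => hx i), ← EReal.coe_add]

/-- The subgradient of `f i` at the new block provided by the optimality of the `i`-th step. -/
def blockSubgrad (D : Data n q m) (xn xo : Blocks n) (y : Eu q) (z : Eu m) (i : Fin p) :
    Eu (n i) :=
  -((D.A i).adjoint (z + D.α • D.residual (sweep xn xo i (xn i)) y) + D.Q i (xn i - xo i))

theorem inner_blockSubgrad (xn xo : Blocks n) (y : Eu q) (z : Eu m) (i : Fin p) (d : Eu (n i)) :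
    inner ℝ (D.blockSubgrad xn xo y z i) d =
      -inner ℝ (z + D.α • D.residual (sweep xn xo i (xn i)) y) (D.A i d) -
        inner ℝ (D.Q i (xn i - xo i)) d := by
  rw [blockSubgrad, inner_neg_left, inner_add_left, ContinuousLinearMap.adjoint_inner_left]
  ring

/-- Comparing the minimizer with `w`, the other blocks cancel and the quadratic terms expand exactly
about `xn i`. The result is a quadratic minorant of `f i` with slope `blockSubgrad`. -/
theorem x_step_subgrad (hS : D.Standing) (h1 : D.A1) {xn xo : Blocks n} {y : Eu q} {z : Eu m}
    {i : Fin p} (hmin : xn i ∈ argmin (fun w : Eu (n i) => D.augL (sweep xn xo i w) y z +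
      ((1 / 2 * inner ℝ (w - xo i) (D.Q i (w - xo i)) : ℝ) : EReal))) :
    D.f i (xn i) ≠ ⊤ ∧ ∀ w : Eu (n i), D.f i (xn i) +
      ((inner ℝ (D.blockSubgrad xn xo y z i) (w - xn i) - D.α / 2 * ‖D.A i (w - xn i)‖ ^ 2 -
        1 / 2 * inner ℝ (w - xn i) (D.Q i (w - xn i)) : ℝ) : EReal) ≤ D.f i w := by
  set c : EReal := ∑ j ∈ Finset.univ.erase i, D.f j (if j < i then xn j else xo j) with hc
  have hsum : ∀ w : Eu (n i), ∑ j, D.f j (sweep xn xo i w j) = D.f i w + c := by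
    intro w
    rw [← Finset.add_sum_erase _ _ (Finset.mem_univ i), hc]
    congr 1
    · simp [sweep]
    · refine Finset.sum_congr rfl fun j hj => ?_
      simp [sweep, Function.update_of_ne (Finset.ne_of_mem_erase hj)]
  have hcb : c ≠ ⊥ := ereal_sum_ne_bot _ fun j _ => (h1.proper j).1 _
  have hf := (h1.proper i).1
  have hform : ∀ w : Eu (n i), D.augL (sweep xn xo i w) y z +
      ((1 / 2 * inner ℝ (w - xo i) (D.Q i (w - xo i)) : ℝ) : EReal) = D.f i w + c +
      ((D.h y + inner ℝ z (D.residual (sweep xn xo i w) y) +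
        D.α / 2 * ‖D.residual (sweep xn xo i w) y‖ ^ 2 +
        1 / 2 * inner ℝ (w - xo i) (D.Q i (w - xo i)) : ℝ) : EReal) := by
    intro w
    rw [augL, hsum, add_assoc (D.f i w + c), ← EReal.coe_add]
  obtain ⟨hlt, hle⟩ := hmin
  simp only [hform] at hlt hle
  refine ⟨(ereal_cancel (hf _) (hf _) hcb hlt (hle (xn i))).1, fun w => ?_⟩
  have h := (ereal_cancel (hf _) (hf w) hcb hlt (hle w)).2
  convert h using 3
  have e1 := residual_sweep (D := D) xn xo i w (xn i) y
  have e2 : w - xo i = (xn i - xo i) + (w - xn i) := by abel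
  have e3 := inner_add_norm_sq_expand D.α z (D.residual (sweep xn xo i (xn i)) y) (D.A i (w - xn i))
  have e4 := inner_map_expand (hS.Q_pos i).isSymmetric (xn i - xo i) (w - xn i)
  rw [inner_blockSubgrad, e1, e2, e4]
  linarith

theorem inner_weakMatrix (i : Fin p) (ε : ℝ) (v w : Eu (n i)) :
    inner ℝ v (D.weakMatrix i ε w) = D.α * inner ℝ (D.A i v) (D.A i w) - ε * inner ℝ v w := by
  simp [weakMatrix, inner_sub_right, inner_smul_right, ContinuousLinearMap.adjoint_inner_right]

theorem weakMatrix_isSymmetric (i : Fin p) (ε : ℝ) :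
    (D.weakMatrix i ε : Eu (n i) →ₗ[ℝ] Eu (n i)).IsSymmetric := by
  intro v w
  simp only [ContinuousLinearMap.coe_coe]
  rw [real_inner_comm, inner_weakMatrix, inner_weakMatrix, real_inner_comm (D.A i v),
    real_inner_comm v]

end Data

/-- A lower quadratic support at `x` gives a Fréchet subgradient. -/
theorem mem_frechetSubdiff_of_quadratic {E : Type*} [NormedAddCommGroup E] [InnerProductSpace ℝ E]
    {Φ : E → EReal} {x s : E} {C : ℝ} (hx : Φ x < ⊤)
    (h : ∀ w, Φ x + ((inner ℝ s (w - x) - C * ‖w - x‖ ^ 2 : ℝ) : EReal) ≤ Φ w) :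
    s ∈ frechetSubdiff Φ x := by
  refine ⟨hx, fun ε hε => ?_⟩
  have hC : 0 < |C| + 1 := by positivity
  filter_upwards [Metric.ball_mem_nhds x (div_pos hε hC)] with w hw
  refine le_trans ?_ (h w)
  refine add_le_add le_rfl (EReal.coe_le_coe_iff.2 ?_)
  rw [Metric.mem_ball, dist_eq_norm, lt_div_iff₀ hC] at hw
  nlinarith [norm_nonneg (w - x), le_abs_self C, mul_nonneg (norm_nonneg (w - x)) (norm_nonneg (w - x)),
    mul_le_mul_of_nonneg_right hw.le (norm_nonneg (w - x))]

theorem frechetSubdiff_subset_limitingSubdiff {E : Type*} [NormedAddCommGroup E]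
    [InnerProductSpace ℝ E] (Φ : E → EReal) (x : E) :
    frechetSubdiff Φ x ⊆ limitingSubdiff Φ x := fun s hs =>
  ⟨hs.1, fun _ => x, fun _ => s, tendsto_const_nhds, tendsto_const_nhds, fun _ => hs,
    tendsto_const_nhds⟩

namespace Data

variable {p : ℕ} {n : Fin p → ℕ} {q m : ℕ} {D : Data n q m}

/-- A coarser minorant with a single quadratic constant. It provides subgradients of `f i` and of L̄
and, tested at the limit point, an upper bound on the values along the iteration. -/
theorem f_support (hS : D.Standing) (h1 : D.A1) {xn xo : Blocks n} {y : Eu q} {z : Eu m}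
    {i : Fin p} (hmin : xn i ∈ argmin (fun w : Eu (n i) => D.augL (sweep xn xo i w) y z +
      ((1 / 2 * inner ℝ (w - xo i) (D.Q i (w - xo i)) : ℝ) : EReal))) (w : Eu (n i)) :
    D.f i (xn i) + ((inner ℝ (D.blockSubgrad xn xo y z i) (w - xn i) -
      (D.α / 2 * ‖D.A i‖ ^ 2 + 1 / 2 * ‖D.Q i‖) * ‖w - xn i‖ ^ 2 : ℝ) : EReal) ≤ D.f i w := by
  refine le_trans ?_ ((x_step_subgrad hS h1 hmin).2 w)
  refine add_le_add le_rfl (EReal.coe_le_coe_iff.2 ?_)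
  have hα := hS.α_pos
  have e1 : ‖D.A i (w - xn i)‖ ^ 2 ≤ (‖D.A i‖ * ‖w - xn i‖) ^ 2 := by
    gcongr; exact (D.A i).le_opNorm _
  have e2 : inner ℝ (w - xn i) (D.Q i (w - xn i)) ≤ ‖w - xn i‖ * (‖D.Q i‖ * ‖w - xn i‖) :=
    (real_inner_le_norm _ _).trans (by gcongr; exact (D.Q i).le_opNorm _)
  have e3 := mul_le_mul_of_nonneg_left e1 (half_pos hα).le
  nlinarith

/-- Test at the old block. Under the first alternative the linear part contributes ‖Δ‖²_Q and the
minorant loses half of it, leaving ½‖Δ‖²_Q ≥ (τ/2)‖Δ‖². Under the second, weak convexity replaces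
the minorant, so (α/2)‖AᵢΔ‖² is not lost; it pays for (ε/2)‖Δ‖² and leaves λ_min(αAᵢᵀAᵢ - εI)/2. -/
theorem block_decrease (hS : D.Standing) (h1 : D.A1) {xn xo : Blocks n} {y : Eu q} {z : Eu m}
    {i : Fin p} (hmin : xn i ∈ argmin (fun w : Eu (n i) => D.augL (sweep xn xo i w) y z +
      ((1 / 2 * inner ℝ (w - xo i) (D.Q i (w - xo i)) : ℝ) : EReal))) {τ : ℝ}
    (hτ : D.IsModulus i τ) (hfo : D.f i (xo i) ≠ ⊤) :
    (D.f i (xn i)).toReal + (inner ℝ (z + D.α • D.residual (sweep xn xo i (xn i)) y)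
      (D.A i (xn i - xo i)) - D.α / 2 * ‖D.A i (xn i - xo i)‖ ^ 2) + τ / 2 * ‖xn i - xo i‖ ^ 2 ≤
      (D.f i (xo i)).toReal := by
  have hb := (h1.proper i).1
  obtain ⟨hfn, hle⟩ := x_step_subgrad hS h1 hmin
  have hin := inner_blockSubgrad (D := D) xn xo y z i (xo i - xn i)
  have hneg : xo i - xn i = -(xn i - xo i) := by abel
  simp only [hneg, map_neg, inner_neg_right] at hin
  have hcomm := real_inner_comm (D.Q i (xn i - xo i)) (xn i - xo i)
  rcases hτ with ⟨-, hτ⟩ | ⟨ε, hε, hw, rfl⟩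
  · have h := hle (xo i)
    rw [hneg, map_neg, map_neg, inner_neg_right, inner_neg_neg, norm_neg,
      ← EReal.coe_toReal hfn (hb _), ← EReal.coe_toReal hfo (hb _), ← EReal.coe_add,
      EReal.coe_le_coe_iff] at h
    have := hτ (xn i - xo i)
    linarith
  · have hmem : D.blockSubgrad xn xo y z i ∈ limitingSubdiff (D.f i) (xn i) :=
      frechetSubdiff_subset_limitingSubdiff _ _
        (mem_frechetSubdiff_of_quadratic hfn.lt_top (f_support hS h1 hmin))
    have h := hw (xo i) (xn i) _ hmem
    rw [hneg, inner_neg_right, norm_neg,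
      ← EReal.coe_toReal hfn (hb _), ← EReal.coe_toReal hfo (hb _), ← EReal.coe_add,
      EReal.coe_le_coe_iff] at h
    have h2 := lamMin_mul_norm_sq_le (D.weakMatrix_isSymmetric i ε) (xn i - xo i)
    rw [inner_weakMatrix, real_inner_self_eq_norm_sq, real_inner_self_eq_norm_sq] at h2
    have h3 := (hS.Q_pos i).inner_nonneg_right (xn i - xo i)
    linarith

theorem x_decrease (hS : D.Standing) (h1 : D.A1) {xn xo : Blocks n} {y : Eu q} {z : Eu m}
    (hmin : ∀ i, xn i ∈ argmin (fun w : Eu (n i) => D.augL (sweep xn xo i w) y z +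
      ((1 / 2 * inner ℝ (w - xo i) (D.Q i (w - xo i)) : ℝ) : EReal))) {τ : Fin p → ℝ}
    (hτ : ∀ i, D.IsModulus i (τ i)) (hfo : ∀ i, D.f i (xo i) ≠ ⊤) :
    D.augR xn y z + ∑ i, τ i / 2 * ‖xn i - xo i‖ ^ 2 ≤ D.augR xo y z := by
  have h := Finset.sum_le_sum fun i (_ : i ∈ Finset.univ) => block_decrease hS h1 (hmin i) (hτ i) (hfo i)
  rw [Finset.sum_add_distrib, Finset.sum_add_distrib] at h
  have ht := sum_partial_inner (fun i => D.A i (xn i - xo i)) (D.residual xo y)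
  simp only [← residual_sweep_self] at ht
  have hr := residual_eq_add (D := D) xo xn y y
  rw [sub_self, map_zero, add_zero] at hr
  rw [← hr] at ht
  have hs : ∑ i, (inner ℝ (z + D.α • D.residual (sweep xn xo i (xn i)) y) (D.A i (xn i - xo i)) -
      D.α / 2 * ‖D.A i (xn i - xo i)‖ ^ 2) = inner ℝ z (D.residual xn y) -
      inner ℝ z (D.residual xo y) + D.α / 2 * (‖D.residual xn y‖ ^ 2 - ‖D.residual xo y‖ ^ 2) := by
    rw [← ht, hr, inner_add_right, inner_sum, Finset.mul_sum, add_sub_cancel_left,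
      ← Finset.sum_add_distrib]
    refine Finset.sum_congr rfl fun i _ => ?_
    rw [inner_add_left, inner_smul_left]
    simp
    ring
  rw [hs] at h
  simp only [augR]
  linarith

end Data
-- The y-step, the multiplier step and sufficient decrease
namespace Data

variable {p : ℕ} {n : Fin p → ℕ} {q m : ℕ} {D : Data n q m}

theorem residual_right (x : Blocks n) (y y' : Eu q) :
    D.residual x y' = D.residual x y + D.B (y' - y) := by
  rw [residual_eq_add x x y y']
  simp

theorem y_step_gradient (hS : D.Standing) (h1 : D.A1) (h2 : D.A2) {xn : Blocks n} {yn yo : Eu q}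
    {z : Eu m} (hfin : ∀ i, D.f i (xn i) ≠ ⊤)
    (hmin : yn ∈ argmin (fun w : Eu q => D.augL xn w z +
      ((1 / 2 * inner ℝ (w - yo) (D.P (w - yo)) : ℝ) : EReal))) :
    gradient D.h yn + (D.B.adjoint (z + D.α • D.residual xn yn) + D.P (yn - yo)) = 0 := by
  refine gradient_add_eq_zero_of_min (C := D.α / 2 * ‖D.B‖ ^ 2 + 1 / 2 * ‖D.P‖)
    (h2.differentiable yn) fun w => ?_
  have h := hmin.2 w
  simp only [augL_eq_coe h1 hfin, ← EReal.coe_add, EReal.coe_le_coe_iff, augR] at h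
  have e1 := residual_right (D := D) xn yn w
  have e2 : w - yo = (yn - yo) + (w - yn) := by abel
  have e3 := inner_add_norm_sq_expand D.α z (D.residual xn yn) (D.B (w - yn))
  rw [e1, e2, inner_map_expand hS.P_pos.isSymmetric] at h
  rw [inner_add_left, ContinuousLinearMap.adjoint_inner_left]
  have hα := hS.α_pos
  have e4 : ‖D.B (w - yn)‖ ^ 2 ≤ (‖D.B‖ * ‖w - yn‖) ^ 2 := by
    gcongr; exact D.B.le_opNorm _
  have e5 : inner ℝ (w - yn) (D.P (w - yn)) ≤ ‖w - yn‖ * (‖D.P‖ * ‖w - yn‖) :=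
    (real_inner_le_norm _ _).trans (by gcongr; exact D.P.le_opNorm _)
  have e6 := mul_le_mul_of_nonneg_left e4 (half_pos hα).le
  nlinarith

/-- Stationarity at `yn` is used rather than the minimizing comparison with `yo`. It gains the whole
‖Δy‖²_P instead of half, which is the source of 2P in D̄. -/
theorem y_decrease (h2 : D.A2) {xn : Blocks n} {yn yo : Eu q} {z : Eu m}
    (hgrad : gradient D.h yn + (D.B.adjoint (z + D.α • D.residual xn yn) + D.P (yn - yo)) = 0) :
    D.augR xn yn z + (inner ℝ (yn - yo) (D.P (yn - yo)) + D.α / 2 * ‖D.B (yn - yo)‖ ^ 2 -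
      D.Lh / 2 * ‖yn - yo‖ ^ 2) ≤ D.augR xn yo z := by
  have h := gradient_lower_bound h2.differentiable h2.lipschitz yn yo
  rw [eq_neg_of_add_eq_zero_left hgrad, inner_neg_left, inner_add_left,
    ContinuousLinearMap.adjoint_inner_left] at h
  have hneg : yo - yn = -(yn - yo) := by abel
  have e1 := residual_right (D := D) xn yn yo
  have e3 := inner_add_norm_sq_expand D.α z (D.residual xn yn) (D.B (yo - yn))
  rw [← e1] at e3
  simp only [hneg, map_neg, inner_neg_right, norm_neg] at h e3
  have hcomm := real_inner_comm (D.P (yn - yo)) (yn - yo)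
  simp only [augR]
  linarith

theorem B_mem_residual (h3 : D.A3) (x : Blocks n) (y : Eu q) : ∃ v, D.B v = D.residual x y := by
  obtain ⟨v, hv⟩ := h3.im_A x
  obtain ⟨w, hw⟩ := h3.b_mem
  exact ⟨v + y + w, by rw [residual, map_add, map_add, hv, hw]⟩

theorem adjoint_comp_isSymmetric :
    ((D.B.adjoint ∘L D.B : Eu q →L[ℝ] Eu q) : Eu q →ₗ[ℝ] Eu q).IsSymmetric := by
  intro v w
  simp [ContinuousLinearMap.adjoint_inner_left, ContinuousLinearMap.adjoint_inner_right]

theorem inner_adjoint_comp (v : Eu q) :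
    inner ℝ v ((D.B.adjoint ∘L D.B) v) = ‖D.B v‖ ^ 2 := by
  simp [ContinuousLinearMap.adjoint_inner_right]

theorem lamB_pos (hS : D.Standing) : 0 < D.lamB := by
  refine lamPos_pos adjoint_comp_isSymmetric ?_
  obtain ⟨v, hv⟩ : ∃ v, D.B v ≠ 0 := by
    by_contra! h
    exact hS.B_ne_zero (ContinuousLinearMap.ext h)
  refine ⟨v, ?_⟩
  rw [inner_adjoint_comp]
  positivity

/-- Bᵀ is bounded below on Im B. The multiplier increments lie there by A3, so BᵀΔz controls Δz. -/
theorem lamB_mul_le (v : Eu q) : D.lamB * ‖D.B v‖ ^ 2 ≤ ‖D.B.adjoint (D.B v)‖ ^ 2 := by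
  have h := lamPos_mul_inner_le (D.adjoint_comp_isSymmetric)
    (fun v => by rw [inner_adjoint_comp]; positivity) v
  rwa [inner_adjoint_comp] at h

theorem rhoBeta_pos (hS : D.Standing) : 0 < D.rhoBeta := by
  have h1 := hS.β_pos
  have h2 := hS.β_lt_two
  rw [rhoBeta, sub_pos, abs_lt]
  constructor <;> linarith

/-- `B ≠ 0` excludes q = 0, where the Lipschitz condition would be void and `Lh` could be negative.
-/
theorem Lh_nonneg (hS : D.Standing) (h2 : D.A2) : 0 ≤ D.Lh := by
  obtain ⟨v, hv⟩ : ∃ v, D.B v ≠ 0 := by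
    by_contra! h
    exact hS.B_ne_zero (ContinuousLinearMap.ext h)
  have hv0 : v ≠ 0 := by rintro rfl; simp at hv
  have h := (norm_nonneg _).trans (h2.lipschitz 0 v)
  rw [sub_zero] at h
  exact nonneg_of_mul_nonneg_left h (norm_pos_iff.2 hv0)

theorem c₂_nonneg (hS : D.Standing) : 0 ≤ D.c₂ := by
  have := lamB_pos hS
  have := rhoBeta_pos hS
  have := hS.α_pos
  have := hS.β_pos
  unfold c₂; positivity

theorem c₃_nonneg (hS : D.Standing) : 0 ≤ D.c₃ := by
  have := c₂_nonneg hS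
  unfold c₃; positivity

theorem c₅_nonneg (hS : D.Standing) : 0 ≤ D.c₅ := by
  have := lamB_pos hS
  have := rhoBeta_pos hS
  have := hS.α_pos
  have := hS.β_pos
  unfold c₅ c₁; positivity

/-- With t = |1-β| and ρ = 1 - t, write t‖a‖ + β‖w‖ = t‖a‖ + ρ(β‖w‖/ρ) and use convexity of the
square; `key` is the exact convexity gap. Then t times the squared left-hand norm is moved across to
form the telescoping difference. -/
theorem norm_sq_relaxed_le {V : Type*} [NormedAddCommGroup V] [InnerProductSpace ℝ V]
    (hS : D.Standing) (a w : V) :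
    D.rhoBeta * ‖(1 - D.β) • a - D.β • w‖ ^ 2 ≤
      |1 - D.β| * (‖a‖ ^ 2 - ‖(1 - D.β) • a - D.β • w‖ ^ 2) + D.β ^ 2 / D.rhoBeta * ‖w‖ ^ 2 := by
  have hρ := rhoBeta_pos hS
  have hβ := hS.β_pos
  have ht : D.rhoBeta = 1 - |1 - D.β| := rfl
  set t := |1 - D.β| with htd
  have ht0 : 0 ≤ t := abs_nonneg _
  have hn : ‖(1 - D.β) • a - D.β • w‖ ≤ t * ‖a‖ + D.β * ‖w‖ := by
    refine (norm_sub_le _ _).trans_eq ?_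
    rw [norm_smul, norm_smul, Real.norm_eq_abs, Real.norm_eq_abs, abs_of_pos hβ]
  have hn2 : ‖(1 - D.β) • a - D.β • w‖ ^ 2 ≤ (t * ‖a‖ + D.β * ‖w‖) ^ 2 := by gcongr
  have key : t * ‖a‖ ^ 2 + D.β ^ 2 / D.rhoBeta * ‖w‖ ^ 2 - (t * ‖a‖ + D.β * ‖w‖) ^ 2 =
      t / D.rhoBeta * (D.rhoBeta * ‖a‖ - D.β * ‖w‖) ^ 2 := by
    have : t = 1 - D.rhoBeta := by rw [ht]; ring
    rw [this]
    field_simp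
    ring
  have : 0 ≤ t / D.rhoBeta * (D.rhoBeta * ‖a‖ - D.β * ‖w‖) ^ 2 := by positivity
  rw [ht] at *
  linarith

/-- This is `norm_sq_relaxed_le` multiplied by κ, which produces the constants of the theorem; the
factor 2 in c₂ comes from (s + t)² ≤ 2s² + 2t². -/
theorem dual_bound (hS : D.Standing) {ζ₁ ζ₂ w : Eu q} {dz : Eu m} {a b : ℝ}
    (hζ : ζ₂ = (1 - D.β) • ζ₁ - D.β • w) (hdz : D.lamB * ‖dz‖ ^ 2 ≤ ‖ζ₂‖ ^ 2)
    (hw : ‖w‖ ≤ (‖D.P‖ + D.Lh) * a + ‖D.P‖ * b) :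
    1 / (D.α * D.β) * ‖dz‖ ^ 2 ≤
      D.c₅ * (‖ζ₁‖ ^ 2 - ‖ζ₂‖ ^ 2) + D.c₄ * a ^ 2 + D.c₃ * b ^ 2 := by
  have hlam := lamB_pos hS
  have hρ := rhoBeta_pos hS
  have hα := hS.α_pos
  have hβ := hS.β_pos
  have hr := norm_sq_relaxed_le hS ζ₁ w
  rw [← hζ] at hr
  have hw2 : ‖w‖ ^ 2 ≤ 2 * ((‖D.P‖ + D.Lh) ^ 2 * a ^ 2 + ‖D.P‖ ^ 2 * b ^ 2) := by
    have : ‖w‖ ^ 2 ≤ ((‖D.P‖ + D.Lh) * a + ‖D.P‖ * b) ^ 2 := by gcongr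
    nlinarith [sq_nonneg ((‖D.P‖ + D.Lh) * a - ‖D.P‖ * b)]
  set κ := 1 / (D.α * D.β * D.lamB * D.rhoBeta) with hκ
  have hκ0 : 0 < κ := by positivity
  have k1 : 1 / (D.α * D.β) = κ * (D.rhoBeta * D.lamB) := by rw [hκ]; field_simp
  have k5 : D.c₅ = κ * |1 - D.β| := by rw [hκ, c₅, c₁]; field_simp
  have k2 : D.c₂ = κ * (2 * (D.β ^ 2 / D.rhoBeta)) := by rw [hκ, c₂]; field_simp
  have hb : 0 < D.β ^ 2 / D.rhoBeta := by positivity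
  rw [k1, k5, c₄, c₃, k2]
  have s1 := mul_le_mul_of_nonneg_left hdz hρ.le
  have s2 := mul_le_mul_of_nonneg_left hw2 hb.le
  have s3 : D.rhoBeta * (D.lamB * ‖dz‖ ^ 2) ≤ |1 - D.β| * (‖ζ₁‖ ^ 2 - ‖ζ₂‖ ^ 2) +
    D.β ^ 2 / D.rhoBeta * (2 * ((‖D.P‖ + D.Lh) ^ 2 * a ^ 2 + ‖D.P‖ ^ 2 * b ^ 2)) := by linarith
  have s4 := mul_le_mul_of_nonneg_left s3 hκ0.le
  linarith

theorem Dbar_isSymmetric (hS : D.Standing) : (D.Dbar : Eu q →ₗ[ℝ] Eu q).IsSymmetric := by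
  intro v w
  have h1 : inner ℝ (D.P v) w = inner ℝ v (D.P w) := hS.P_pos.isSymmetric v w
  simp [Dbar, inner_sub_left, inner_add_left, inner_sub_right, inner_add_right, inner_smul_left,
    inner_smul_right, h1, ContinuousLinearMap.adjoint_inner_left,
    ContinuousLinearMap.adjoint_inner_right]

theorem inner_Dbar (v : Eu q) : inner ℝ v (D.Dbar v) = 2 * inner ℝ v (D.P v) +
    D.α * ‖D.B v‖ ^ 2 - D.Lh * ‖v‖ ^ 2 - 2 * D.ε₀ * (D.c₃ + D.c₄) * ‖v‖ ^ 2 := by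
  simp [Dbar, inner_sub_right, inner_add_right, inner_smul_right,
    ContinuousLinearMap.adjoint_inner_right]

/-- The real-valued modified augmented Lagrangian along the iteration. -/
def LbarR (D : Data n q m) (x : ℕ → Blocks n) (y : ℕ → Eu q) (z : ℕ → Eu m) (k : ℕ) : ℝ :=
  D.augR (x (k + 1)) (y (k + 1)) (z (k + 1)) +
    (D.ε₀ * D.c₅ * ‖D.B.adjoint (z (k + 1) - z k)‖ ^ 2 + D.ε₀ * D.c₃ * ‖y (k + 1) - y k‖ ^ 2)

theorem finite_iterate (hS : D.Standing) (h1 : D.A1) {x : ℕ → Blocks n} {y : ℕ → Eu q}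
    {z : ℕ → Eu m} (hit : D.IsIteration x y z) (k : ℕ) (i : Fin p) : D.f i (x (k + 1) i) ≠ ⊤ :=
  (x_step_subgrad hS h1 (hit.x_step k i)).1

/-- Index shift: `LbarR x y z k` belongs to iterate k + 1. Iterate 0 has no predecessor and need not
lie in the domain of the objective. -/
theorem LbarSeq_succ (hS : D.Standing) (h1 : D.A1) {x : ℕ → Blocks n} {y : ℕ → Eu q}
    {z : ℕ → Eu m} (hit : D.IsIteration x y z) (k : ℕ) :
    D.LbarSeq x y z (k + 1) = (D.LbarR x y z k : EReal) := by
  rw [LbarR, EReal.coe_add, ← augL_eq_coe h1 (finite_iterate hS h1 hit k)]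
  rfl

theorem norm_triple_sq (x : Blocks n) (y : Eu q) (z : Eu m) :
    ‖triple x y z‖ ^ 2 = ∑ i, ‖x i‖ ^ 2 + ‖y‖ ^ 2 + ‖z‖ ^ 2 := by
  rw [triple, WithLp.prod_norm_sq_eq_of_L2, WithLp.prod_norm_sq_eq_of_L2,
    PiLp.norm_sq_eq_of_L2]
  simp [add_assoc]

theorem triple_sub (x x' : Blocks n) (y y' : Eu q) (z z' : Eu m) :
    triple x y z - triple x' y' z' = triple (x - x') (y - y') (z - z') := rfl

/-- The increase ‖Δz‖²/(αβ) is offset by ε₀ times `dual_bound`, leaving a surplus (ε₀-1)/(αβ)‖Δz‖².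
The c₅ terms and the old c₃ term cancel against L̄, while the new c₃ term and the c₄ term are
charged to the y-step: this is the part 2ε₀(c₃+c₄) of D̄. -/
theorem descent (hS : D.Standing) (h1 : D.A1) (h2 : D.A2) (h3 : D.A3) {τ : Fin p → ℝ}
    (hτ : ∀ i, D.IsModulus i (τ i)) {x : ℕ → Blocks n} {y : ℕ → Eu q} {z : ℕ → Eu m}
    (hit : D.IsIteration x y z) (k : ℕ) :
    D.LbarR x y z (k + 1) + D.sigma τ * ‖triple (x (k + 2)) (y (k + 2)) (z (k + 2)) -
      triple (x (k + 1)) (y (k + 1)) (z (k + 1))‖ ^ 2 ≤ D.LbarR x y z k := by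
  have hα := hS.α_pos
  have hβ := hS.β_pos
  have hfin := finite_iterate hS h1 hit
  have hx := x_decrease hS h1 (hit.x_step (k + 1)) hτ (hfin k)
  have hg1 := y_step_gradient hS h1 h2 (hfin k) (hit.y_step k)
  have hg2 := y_step_gradient hS h1 h2 (hfin (k + 1)) (hit.y_step (k + 1))
  have hy := y_decrease h2 hg2
  have hz1 := hit.z_step k
  have hz2 := hit.z_step (k + 1)
  simp only [add_assoc, one_add_one_eq_two] at hx hg2 hy hz2
  have hαβ : D.α * D.β ≠ 0 := by positivity
  have hd1 : z (k + 1) - z k = (D.α * D.β) • D.residual (x (k + 1)) (y (k + 1)) := by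
    rw [hz1]; abel
  have hd2 : z (k + 2) - z (k + 1) = (D.α * D.β) • D.residual (x (k + 2)) (y (k + 2)) := by
    rw [hz2]; abel
  have hr1 : D.α • D.residual (x (k + 1)) (y (k + 1)) = D.β⁻¹ • (z (k + 1) - z k) := by
    rw [hd1, smul_smul]; congr 1; field_simp
  have hr2 : D.α • D.residual (x (k + 2)) (y (k + 2)) = D.β⁻¹ • (z (k + 2) - z (k + 1)) := by
    rw [hd2, smul_smul]; congr 1; field_simp
  rw [hr1, map_add, map_smul] at hg1
  rw [hr2, map_add, map_smul] at hg2
  set ζ₁ := D.B.adjoint (z (k + 1) - z k) with hζ₁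
  set ζ₂ := D.B.adjoint (z (k + 2) - z (k + 1)) with hζ₂
  -- Since α times the residual is Δz/β, this is β times the difference of two consecutive
  -- stationarity conditions of the y-step.
  have hζ : ζ₂ = (1 - D.β) • ζ₁ - D.β • ((gradient D.h (y (k + 2)) - gradient D.h (y (k + 1))) +
      D.P (y (k + 2) - y (k + 1)) - D.P (y (k + 1) - y k)) := by
    have e : ζ₁ = D.B.adjoint (z (k + 1)) - D.B.adjoint (z k) := map_sub _ _ _
    have e2 : ζ₂ = D.β • (D.β⁻¹ • ζ₂) := by rw [smul_smul, mul_inv_cancel₀ hβ.ne', one_smul]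
    have e1 : ζ₁ = D.β • (D.β⁻¹ • ζ₁) := by rw [smul_smul, mul_inv_cancel₀ hβ.ne', one_smul]
    have g1 : D.β⁻¹ • ζ₁ = -(gradient D.h (y (k + 1)) + D.B.adjoint (z k) +
        D.P (y (k + 1) - y k)) := by
      rw [eq_neg_iff_add_eq_zero, ← hg1]; abel
    have g2 : D.β⁻¹ • ζ₂ = -(gradient D.h (y (k + 2)) + D.B.adjoint (z (k + 1)) +
        D.P (y (k + 2) - y (k + 1))) := by
      rw [eq_neg_iff_add_eq_zero, ← hg2]; abel
    rw [sub_smul, one_smul]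
    nth_rw 1 [e1]
    rw [e2, g1, g2, e, ← smul_sub, ← smul_sub]
    congr 1
    abel
  have hlam : D.lamB * ‖z (k + 2) - z (k + 1)‖ ^ 2 ≤ ‖ζ₂‖ ^ 2 := by
    obtain ⟨v, hv⟩ := B_mem_residual h3 (x (k + 2)) (y (k + 2))
    rw [hζ₂, hd2, ← hv, ← map_smul]
    exact lamB_mul_le _
  have hdual := dual_bound (a := ‖y (k + 2) - y (k + 1)‖) (b := ‖y (k + 1) - y k‖) hS hζ hlam (by
    refine (norm_sub_le _ _).trans (add_le_add ((norm_add_le _ _).trans ?_) (D.P.le_opNorm _))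
    rw [add_mul, add_comm]
    exact add_le_add (D.P.le_opNorm _) (h2.lipschitz _ _))
  have hzz : D.augR (x (k + 2)) (y (k + 2)) (z (k + 2)) = D.augR (x (k + 2)) (y (k + 2)) (z (k + 1))
      + 1 / (D.α * D.β) * ‖z (k + 2) - z (k + 1)‖ ^ 2 := by
    have : inner ℝ (z (k + 2)) (D.residual (x (k + 2)) (y (k + 2))) =
        inner ℝ (z (k + 1)) (D.residual (x (k + 2)) (y (k + 2))) +
        1 / (D.α * D.β) * ‖z (k + 2) - z (k + 1)‖ ^ 2 := by
      have hzadd : z (k + 2) = z (k + 1) + (D.α * D.β) • D.residual (x (k + 2)) (y (k + 2)) := hz2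
      rw [hd2, norm_smul, Real.norm_eq_abs, mul_pow, sq_abs, hzadd, inner_add_left,
        inner_smul_left, real_inner_self_eq_norm_sq]
      simp only [conj_trivial]
      field_simp
    simp only [augR, this]
    ring
  have hDb := lamMin_mul_norm_sq_le (Dbar_isSymmetric hS) (y (k + 2) - y (k + 1))
  rw [inner_Dbar] at hDb
  have σ1 : D.sigma τ ≤ lamMin D.Dbar / 2 := min_le_left _ _
  have σ2 : ∀ i, D.sigma τ ≤ τ i / 2 := fun i =>
    ((min_le_right _ _).trans (min_le_left _ _)).trans
      (by gcongr; exact ciInf_le (Set.finite_range τ).bddBelow i)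
  have σ3 : D.sigma τ ≤ (D.ε₀ - 1) / (D.α * D.β) := (min_le_right _ _).trans (min_le_right _ _)
  have t1 := mul_le_mul_of_nonneg_right σ1 (sq_nonneg ‖y (k + 2) - y (k + 1)‖)
  have t2 : ∑ i, D.sigma τ * ‖(x (k + 2) - x (k + 1)) i‖ ^ 2 ≤
      ∑ i, τ i / 2 * ‖x (k + 2) i - x (k + 1) i‖ ^ 2 :=
    Finset.sum_le_sum fun i _ => mul_le_mul_of_nonneg_right (σ2 i) (sq_nonneg _)
  have t3 := mul_le_mul_of_nonneg_right σ3 (sq_nonneg ‖z (k + 2) - z (k + 1)‖)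
  have t4 := mul_le_mul_of_nonneg_left hdual (zero_le_one.trans hS.ε₀_gt_one.le)
  have t5 : (D.ε₀ - 1) / (D.α * D.β) * ‖z (k + 2) - z (k + 1)‖ ^ 2 =
    D.ε₀ * (1 / (D.α * D.β) * ‖z (k + 2) - z (k + 1)‖ ^ 2) -
      1 / (D.α * D.β) * ‖z (k + 2) - z (k + 1)‖ ^ 2 := by ring
  rw [triple_sub, norm_triple_sq, mul_add, mul_add, Finset.mul_sum]
  simp only [LbarR, add_assoc, one_add_one_eq_two, ← hζ₁, ← hζ₂]
  rw [hzz]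
  linarith

end Data

/-! ### An explicit subgradient of the modified Lagrangian and its size -/

theorem norm_toLp_prod_le {E F : Type*} [NormedAddCommGroup E] [NormedAddCommGroup F]
    (a : E) (b : F) : ‖(WithLp.toLp 2 (a, b) : WithLp 2 (E × F))‖ ≤ ‖a‖ + ‖b‖ := by
  refine le_of_sq_le_sq ?_ (by positivity)
  rw [WithLp.prod_norm_sq_eq_of_L2]
  change ‖a‖ ^ 2 + ‖b‖ ^ 2 ≤ _
  nlinarith [norm_nonneg a, norm_nonneg b, mul_nonneg (norm_nonneg a) (norm_nonneg b)]

theorem norm_blocks_le_sum {p : ℕ} {n : Fin p → ℕ} (x : Blocks n) : ‖x‖ ≤ ∑ i, ‖x i‖ := by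
  refine le_of_sq_le_sq ?_ (by positivity)
  rw [PiLp.norm_sq_eq_of_L2]
  exact Finset.sum_sq_le_sq_sum_of_nonneg fun i _ => norm_nonneg _

theorem sum_norm_le_sqrt_mul_norm_triple {p : ℕ} {n : Fin p → ℕ} {q m : ℕ} (x : Blocks n)
    (y : Eu q) (z : Eu m) :
    ∑ i, ‖x i‖ + ‖y‖ + ‖z‖ ≤ Real.sqrt ((p : ℝ) + 2) * ‖triple x y z‖ := by
  refine le_of_sq_le_sq ?_ (by positivity)
  rw [mul_pow, Real.sq_sqrt (by positivity), Data.norm_triple_sq]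
  -- The two `Option` layers add indices for y and z to the p blocks, so Cauchy–Schwarz yields p +
  -- 2, the factor in ᾱ.
  have h := sq_sum_le_card_mul_sum_sq (s := (Finset.univ : Finset (Option (Option (Fin p)))))
    (f := fun o => o.elim ‖z‖ fun o => o.elim ‖y‖ fun i => ‖x i‖)
  simp only [Fintype.sum_option, Option.elim_none, Option.elim_some, Finset.card_univ,
    Fintype.card_option, Fintype.card_fin] at h
  push_cast at h
  calc _ = (‖z‖ + (‖y‖ + ∑ i, ‖x i‖)) ^ 2 := by ring
    _ ≤ _ := h
    _ = _ := by ring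

namespace Data

variable {p : ℕ} {n : Fin p → ℕ} {q m : ℕ} {D : Data n q m}

/-- The subgradient of the modified augmented Lagrangian at the new iterate. -/
def LbarSubgrad (D : Data n q m) (xn xo : Blocks n) (yn yo : Eu q) (zn zo : Eu m) :
    Quintuple n q m :=
  quintuple
    (WithLp.toLp 2 fun i => D.blockSubgrad xn xo yo zo i +
      (D.A i).adjoint (zn + D.α • D.residual xn yn))
    (gradient D.h yn + D.B.adjoint (zn + D.α • D.residual xn yn) +
      (2 * D.ε₀ * D.c₃) • (yn - yo))
    (D.residual xn yn + (2 * D.ε₀ * D.c₅) • D.B (D.B.adjoint (zn - zo)))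
    (-((2 * D.ε₀ * D.c₃) • (yn - yo)))
    (-((2 * D.ε₀ * D.c₅) • D.B (D.B.adjoint (zn - zo))))

theorem inner_quintuple (x x' : Blocks n) (y y' : Eu q) (z z' : Eu m) (u u' : Eu q) (v v' : Eu m) :
    inner ℝ (quintuple x y z u v) (quintuple x' y' z' u' v') =
      ∑ i, inner ℝ (x i) (x' i) + (inner ℝ y y' + (inner ℝ z z' + (inner ℝ u u' + inner ℝ v v'))) := by
  simp [quintuple, WithLp.prod_inner_apply, PiLp.inner_apply]

/-- Only two second-order terms can be negative: that of h, bounded through `Lh`, and the bilinear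
coupling of `dz` with the residual. The other quadratic remainders are nonnegative and dropped. -/
theorem smooth_support (hS : D.Standing) (h2 : D.A2) (xn : Blocks n) (yn yo : Eu q) (zn zo : Eu m)
    (dx : Blocks n) (dy dy' : Eu q) (dz dz' : Eu m) :
    (D.h yn + inner ℝ zn (D.residual xn yn) + D.α / 2 * ‖D.residual xn yn‖ ^ 2 +
      (D.ε₀ * D.c₅ * ‖D.B.adjoint (zn - zo)‖ ^ 2 + D.ε₀ * D.c₃ * ‖yn - yo‖ ^ 2)) +
      (∑ i, inner ℝ ((D.A i).adjoint (zn + D.α • D.residual xn yn)) (dx i) +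
        (inner ℝ (gradient D.h yn + D.B.adjoint (zn + D.α • D.residual xn yn) +
          (2 * D.ε₀ * D.c₃) • (yn - yo)) dy +
        (inner ℝ (D.residual xn yn + (2 * D.ε₀ * D.c₅) • D.B (D.B.adjoint (zn - zo))) dz +
        (inner ℝ (-((2 * D.ε₀ * D.c₃) • (yn - yo))) dy' +
          inner ℝ (-((2 * D.ε₀ * D.c₅) • D.B (D.B.adjoint (zn - zo)))) dz')))) -
      (D.Lh / 2 * ‖dy‖ ^ 2 + ‖dz‖ * (∑ i, ‖D.A i‖ * ‖dx i‖ + ‖D.B‖ * ‖dy‖)) ≤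
    D.h (yn + dy) + inner ℝ (zn + dz) (D.residual (xn + dx) (yn + dy)) +
      D.α / 2 * ‖D.residual (xn + dx) (yn + dy)‖ ^ 2 +
      (D.ε₀ * D.c₅ * ‖D.B.adjoint (zn + dz - (zo + dz'))‖ ^ 2 +
        D.ε₀ * D.c₃ * ‖yn + dy - (yo + dy')‖ ^ 2) := by
  have hc3 := c₃_nonneg hS
  have hc5 := c₅_nonneg hS
  have hα := hS.α_pos
  have hε : 0 < D.ε₀ := zero_lt_one.trans hS.ε₀_gt_one
  have hh := gradient_lower_bound h2.differentiable h2.lipschitz yn (yn + dy)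
  rw [add_sub_cancel_left] at hh
  have hr : D.residual (xn + dx) (yn + dy) = D.residual xn yn + (∑ i, D.A i (dx i) + D.B dy) := by
    rw [residual_eq_add xn _ yn, add_assoc]
    simp
  set a := ∑ i, D.A i (dx i) + D.B dy with ha
  have hq := inner_add_norm_sq_expand D.α zn (D.residual xn yn) a
  have hsum : inner ℝ (zn + D.α • D.residual xn yn) a =
      ∑ i, inner ℝ ((D.A i).adjoint (zn + D.α • D.residual xn yn)) (dx i) +
      inner ℝ (D.B.adjoint (zn + D.α • D.residual xn yn)) dy := by
    simp only [ha, inner_add_right, inner_sum, ContinuousLinearMap.adjoint_inner_left]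
  have hdz : -(‖dz‖ * (∑ i, ‖D.A i‖ * ‖dx i‖ + ‖D.B‖ * ‖dy‖)) ≤ inner ℝ dz a := by
    refine neg_le_of_abs_le ((abs_real_inner_le_norm _ _).trans ?_)
    gcongr
    refine (norm_add_le _ _).trans (add_le_add ((norm_sum_le _ _).trans ?_) (D.B.le_opNorm _))
    exact Finset.sum_le_sum fun i _ => (D.A i).le_opNorm _
  have e5 : ‖D.B.adjoint (zn + dz - (zo + dz'))‖ ^ 2 = ‖D.B.adjoint (zn - zo)‖ ^ 2 +
      2 * (inner ℝ (D.B (D.B.adjoint (zn - zo))) dz - inner ℝ (D.B (D.B.adjoint (zn - zo))) dz') +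
      ‖D.B.adjoint (dz - dz')‖ ^ 2 := by
    have : zn + dz - (zo + dz') = (zn - zo) + (dz - dz') := by abel
    rw [this, map_add, @norm_add_sq_real, ContinuousLinearMap.adjoint_inner_right, inner_sub_right]
  have e3 : ‖yn + dy - (yo + dy')‖ ^ 2 = ‖yn - yo‖ ^ 2 +
      2 * (inner ℝ (yn - yo) dy - inner ℝ (yn - yo) dy') + ‖dy - dy'‖ ^ 2 := by
    have : yn + dy - (yo + dy') = (yn - yo) + (dy - dy') := by abel
    rw [this, @norm_add_sq_real, inner_sub_right]
  have p1 : 0 ≤ D.α / 2 * ‖a‖ ^ 2 := by positivity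
  have p2 : 0 ≤ D.ε₀ * D.c₅ * ‖D.B.adjoint (dz - dz')‖ ^ 2 := by positivity
  have p3 : 0 ≤ D.ε₀ * D.c₃ * ‖dy - dy'‖ ^ 2 := by positivity
  rw [e5, e3, hr]
  rw [inner_add_left zn dz, inner_add_right dz]
  rw [inner_add_left (gradient D.h yn + _), inner_add_left (gradient D.h yn),
    inner_add_left (D.residual xn yn), inner_neg_left, inner_neg_left]
  simp only [inner_smul_left, conj_trivial]
  rw [real_inner_comm dz (D.residual xn yn)]
  rw [hsum] at hq
  linarith

theorem norm_fst_le_quintuple (x : Blocks n) (y : Eu q) (z : Eu m) (u : Eu q) (v : Eu m) :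
    (∀ i, ‖x i‖ ≤ ‖quintuple x y z u v‖) ∧ ‖y‖ ≤ ‖quintuple x y z u v‖ ∧
      ‖z‖ ≤ ‖quintuple x y z u v‖ := by
  have h : ‖quintuple x y z u v‖ ^ 2 =
      ∑ i, ‖x i‖ ^ 2 + (‖y‖ ^ 2 + (‖z‖ ^ 2 + (‖u‖ ^ 2 + ‖v‖ ^ 2))) := by
    simp [quintuple, WithLp.prod_norm_sq_eq_of_L2, PiLp.norm_sq_eq_of_L2]
  have hs : 0 ≤ ∑ i, ‖x i‖ ^ 2 := by positivity
  refine ⟨fun i => ?_, ?_, ?_⟩ <;> refine le_of_sq_le_sq ?_ (norm_nonneg _) <;> rw [h]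
  · have := Finset.single_le_sum (f := fun i => ‖x i‖ ^ 2) (fun i _ => sq_nonneg _)
      (Finset.mem_univ i)
    nlinarith [sq_nonneg ‖y‖, sq_nonneg ‖z‖, sq_nonneg ‖u‖, sq_nonneg ‖v‖]
  · nlinarith [sq_nonneg ‖y‖, sq_nonneg ‖z‖, sq_nonneg ‖u‖, sq_nonneg ‖v‖]
  · nlinarith [sq_nonneg ‖y‖, sq_nonneg ‖z‖, sq_nonneg ‖u‖, sq_nonneg ‖v‖]

theorem Lbar_lt_top_of_finite (h1 : D.A1) {xn : Blocks n} (hx : ∀ i, D.f i (xn i) ≠ ⊤)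
    (yn yo : Eu q) (zn zo : Eu m) : D.Lbar (quintuple xn yn zn yo zo) < ⊤ := by
  have : D.Lbar (quintuple xn yn zn yo zo) = D.augL xn yn zn + _ := rfl
  rw [this, augL_eq_coe h1 hx, ← EReal.coe_add]
  exact EReal.coe_lt_top _

/-- The minorants of the `f i` and of the smooth part add up to one quadratic minorant of L̄, so no
subdifferential sum rule is needed. -/
theorem LbarSubgrad_mem (hS : D.Standing) (h1 : D.A1) (h2 : D.A2) {xn xo : Blocks n}
    {yn yo : Eu q} {zn zo : Eu m}
    (hmin : ∀ i, xn i ∈ argmin (fun w : Eu (n i) => D.augL (sweep xn xo i w) yo zo +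
      ((1 / 2 * inner ℝ (w - xo i) (D.Q i (w - xo i)) : ℝ) : EReal))) :
    D.LbarSubgrad xn xo yn yo zn zo ∈
      frechetSubdiff D.Lbar (quintuple xn yn zn yo zo) := by
  have hfin : ∀ i, D.f i (xn i) ≠ ⊤ := fun i => (x_step_subgrad hS h1 (hmin i)).1
  refine mem_frechetSubdiff_of_quadratic
    (C := ∑ i, (D.α / 2 * ‖D.A i‖ ^ 2 + 1 / 2 * ‖D.Q i‖) + (D.Lh / 2 + (∑ i, ‖D.A i‖ + ‖D.B‖)))
    (Lbar_lt_top_of_finite h1 hfin _ _ _ _) fun w => ?_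
  obtain ⟨dx, dy, dz, dy', dz', rfl⟩ : ∃ dx dy dz dy' dz',
      w = quintuple (xn + dx) (yn + dy) (zn + dz) (yo + dy') (zo + dz') :=
    ⟨w.fst - xn, w.snd.fst - yn, w.snd.snd.fst - zn, w.snd.snd.snd.fst - yo,
      w.snd.snd.snd.snd - zo, by simp only [add_sub_cancel]; rfl⟩
  have hsub : quintuple (xn + dx) (yn + dy) (zn + dz) (yo + dy') (zo + dz') -
      quintuple xn yn zn yo zo = quintuple dx dy dz dy' dz' := by
    have : quintuple (xn + dx) (yn + dy) (zn + dz) (yo + dy') (zo + dz') =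
      quintuple xn yn zn yo zo + quintuple dx dy dz dy' dz' := rfl
    rw [this, add_sub_cancel_left]
  rw [hsub]
  by_cases hw : ∀ i, D.f i ((xn + dx) i) ≠ ⊤
  swap
  · obtain ⟨i, hi⟩ := not_forall.1 hw
    rw [not_not] at hi
    have hL : D.augL (xn + dx) (yn + dy) (zn + dz) = ⊤ := by
      rw [augL]
      have : ∑ i, D.f i ((xn + dx) i) = ⊤ := by
        by_contra hne
        exact ereal_ne_top_of_sum_ne_top _ (fun j _ => (h1.proper j).1 _) hne i
          (Finset.mem_univ i) hi
      rw [this, EReal.top_add_coe]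
    have : D.Lbar (quintuple (xn + dx) (yn + dy) (zn + dz) (yo + dy') (zo + dz')) = ⊤ := by
      have e : D.Lbar (quintuple (xn + dx) (yn + dy) (zn + dz) (yo + dy') (zo + dz')) =
        D.augL (xn + dx) (yn + dy) (zn + dz) + _ := rfl
      rw [e, hL, EReal.top_add_coe]
    rw [this]
    exact le_top
  have eN : D.Lbar (quintuple (xn + dx) (yn + dy) (zn + dz) (yo + dy') (zo + dz')) =
      ((D.augR (xn + dx) (yn + dy) (zn + dz) +
      (D.ε₀ * D.c₅ * ‖D.B.adjoint (zn + dz - (zo + dz'))‖ ^ 2 +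
        D.ε₀ * D.c₃ * ‖yn + dy - (yo + dy')‖ ^ 2) : ℝ) : EReal) := by
    rw [EReal.coe_add, ← augL_eq_coe h1 hw]; rfl
  have eO : D.Lbar (quintuple xn yn zn yo zo) = ((D.augR xn yn zn +
      (D.ε₀ * D.c₅ * ‖D.B.adjoint (zn - zo)‖ ^ 2 + D.ε₀ * D.c₃ * ‖yn - yo‖ ^ 2) : ℝ) : EReal) := by
    rw [EReal.coe_add, ← augL_eq_coe h1 hfin]; rfl
  rw [eN, eO, ← EReal.coe_add, EReal.coe_le_coe_iff]
  have hsm := smooth_support hS h2 xn yn yo zn zo dx dy dy' dz dz'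
  have hfs : ∀ i, (D.f i (xn i)).toReal + (inner ℝ (D.blockSubgrad xn xo yo zo i) (dx i) -
      (D.α / 2 * ‖D.A i‖ ^ 2 + 1 / 2 * ‖D.Q i‖) * ‖dx i‖ ^ 2) ≤ (D.f i ((xn + dx) i)).toReal := by
    intro i
    have h := f_support hS h1 (hmin i) ((xn + dx) i)
    have e : (xn + dx) i - xn i = dx i := add_sub_cancel_left _ _
    rw [e, ← EReal.coe_toReal (hfin i) ((h1.proper i).1 _),
      ← EReal.coe_toReal (hw i) ((h1.proper i).1 _), ← EReal.coe_add, EReal.coe_le_coe_iff] at h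
    exact h
  have hfsum := Finset.sum_le_sum fun i (_ : i ∈ Finset.univ) => hfs i
  rw [Finset.sum_add_distrib, Finset.sum_sub_distrib] at hfsum
  rw [LbarSubgrad, inner_quintuple]
  simp only [inner_add_left (D.blockSubgrad xn xo yo zo _)]
  rw [Finset.sum_add_distrib]
  obtain ⟨n1, n2, n3⟩ := norm_fst_le_quintuple dx dy dz dy' dz'
  set N := ‖quintuple dx dy dz dy' dz'‖ with hN
  have hN0 : 0 ≤ N := norm_nonneg _
  have hα := hS.α_pos
  have hLh := Lh_nonneg hS h2
  have b1 : ∑ i, (D.α / 2 * ‖D.A i‖ ^ 2 + 1 / 2 * ‖D.Q i‖) * ‖dx i‖ ^ 2 ≤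
      (∑ i, (D.α / 2 * ‖D.A i‖ ^ 2 + 1 / 2 * ‖D.Q i‖)) * N ^ 2 := by
    rw [Finset.sum_mul]
    refine Finset.sum_le_sum fun i _ => ?_
    gcongr
    exact n1 i
  have b2 : D.Lh / 2 * ‖dy‖ ^ 2 ≤ D.Lh / 2 * N ^ 2 := by gcongr
  have b3 : ‖dz‖ * (∑ i, ‖D.A i‖ * ‖dx i‖ + ‖D.B‖ * ‖dy‖) ≤
      N * ((∑ i, ‖D.A i‖) * N + ‖D.B‖ * N) := by
    rw [Finset.sum_mul]
    gcongr with i _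
    exact n1 i
  simp only [augR]
  linarith

end Data
namespace Data

variable {p : ℕ} {n : Fin p → ℕ} {q m : ℕ} {D : Data n q m}

theorem norm_quintuple_le (x : Blocks n) (y : Eu q) (z : Eu m) (u : Eu q) (v : Eu m) :
    ‖quintuple x y z u v‖ ≤ ∑ i, ‖x i‖ + (‖y‖ + (‖z‖ + (‖u‖ + ‖v‖))) :=
  (norm_toLp_prod_le _ _).trans (add_le_add (norm_blocks_le_sum x)
    ((norm_toLp_prod_le _ _).trans (add_le_add le_rfl
      ((norm_toLp_prod_le _ _).trans (add_le_add le_rfl (norm_toLp_prod_le _ _))))))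

/-- After block i is updated only the blocks j > i, y and z still move, so the component consists of
their increments and the proximal term. -/
theorem norm_block_component_le (hα : 0 < D.α) (xn xo : Blocks n) (yn yo : Eu q) (zn zo : Eu m)
    (i : Fin p) : ‖D.blockSubgrad xn xo yo zo i +
      (D.A i).adjoint (zn + D.α • D.residual xn yn)‖ ≤ ‖D.A i‖ * ‖zn - zo‖ +
      D.α * ‖D.A i‖ * (∑ j, ‖D.A j‖ * ‖xn j - xo j‖ + ‖D.B‖ * ‖yn - yo‖) +
      ‖D.Q i‖ * ‖xn i - xo i‖ := by
  have hres : D.residual xn yn - D.residual (sweep xn xo i (xn i)) yo =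
      ∑ j, (if j ≤ i then 0 else D.A j (xn j - xo j)) + D.B (yn - yo) := by
    rw [residual_sweep_self, residual_eq_add xo xn yo yn]
    have : ∑ j, D.A j (xn j - xo j) = ∑ j, (if j ≤ i then D.A j (xn j - xo j) else 0) +
        ∑ j, (if j ≤ i then 0 else D.A j (xn j - xo j)) := by
      rw [← Finset.sum_add_distrib]
      refine Finset.sum_congr rfl fun j _ => ?_
      split_ifs <;> simp
    rw [this]
    abel
  have hnorm : ‖D.residual xn yn - D.residual (sweep xn xo i (xn i)) yo‖ ≤
      ∑ j, ‖D.A j‖ * ‖xn j - xo j‖ + ‖D.B‖ * ‖yn - yo‖ := by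
    rw [hres]
    refine (norm_add_le _ _).trans (add_le_add ((norm_sum_le _ _).trans ?_) (D.B.le_opNorm _))
    refine Finset.sum_le_sum fun j _ => ?_
    split_ifs
    · rw [norm_zero]; positivity
    · exact (D.A j).le_opNorm _
  have heq : D.blockSubgrad xn xo yo zo i + (D.A i).adjoint (zn + D.α • D.residual xn yn) =
      (D.A i).adjoint (zn - zo) + D.α • (D.A i).adjoint
        (D.residual xn yn - D.residual (sweep xn xo i (xn i)) yo) - D.Q i (xn i - xo i) := by
    simp only [blockSubgrad, map_add, map_sub, map_smul, smul_sub]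
    abel
  have hadj : ∀ w, ‖(D.A i).adjoint w‖ ≤ ‖D.A i‖ * ‖w‖ := fun w => by
    simpa using (D.A i).adjoint.le_opNorm w
  rw [heq]
  refine (norm_sub_le _ _).trans (add_le_add ((norm_add_le _ _).trans
    (add_le_add (hadj _) ?_)) ((D.Q i).le_opNorm _))
  rw [norm_smul, Real.norm_eq_abs, abs_of_pos hα, mul_assoc]
  gcongr
  exact (hadj _).trans (by gcongr)

theorem sum_mul_le_sum_mul_sum {ι : Type*} (s : Finset ι) {a b : ι → ℝ} (ha : ∀ i ∈ s, 0 ≤ a i)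
    (hb : ∀ i ∈ s, 0 ≤ b i) : ∑ i ∈ s, a i * b i ≤ (∑ i ∈ s, a i) * ∑ i ∈ s, b i := by
  rw [Finset.sum_mul]
  exact Finset.sum_le_sum fun i hi =>
    mul_le_mul_of_nonneg_left (Finset.single_le_sum hb hi) (ha i hi)

/-- Stationarity turns the gradient in y into BᵀΔz - PΔy, and the multiplier update turns the
residual into Δz/(αβ). The terms 2ε₀c₃ and 2ε₀c₅ each occur in two components, hence the 4 in ρ̃. -/
theorem norm_LbarSubgrad_le (hS : D.Standing) {xn xo : Blocks n} {yn yo : Eu q} {zn zo : Eu m}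
    (hgrad : gradient D.h yn + (D.B.adjoint (zo + D.α • D.residual xn yn) + D.P (yn - yo)) = 0)
    (hz : zn = zo + (D.α * D.β) • D.residual xn yn) :
    ‖D.LbarSubgrad xn xo yn yo zn zo‖ ≤
      D.rhoTilde * (∑ i, ‖xn i - xo i‖ + ‖yn - yo‖ + ‖zn - zo‖) := by
  have hα := hS.α_pos
  have hβ := hS.β_pos
  have hε : 0 < D.ε₀ := zero_lt_one.trans hS.ε₀_gt_one
  have hc3 := c₃_nonneg hS
  have hc5 := c₅_nonneg hS
  have hadj : ∀ w, ‖D.B.adjoint w‖ ≤ ‖D.B‖ * ‖w‖ := fun w => by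
    simpa using D.B.adjoint.le_opNorm w
  have hBB : ‖(2 * D.ε₀ * D.c₅) • D.B (D.B.adjoint (zn - zo))‖ ≤
      2 * D.ε₀ * D.c₅ * (‖D.B‖ ^ 2 * ‖zn - zo‖) := by
    rw [norm_smul, Real.norm_eq_abs, abs_of_nonneg (by positivity)]
    gcongr
    refine (D.B.le_opNorm _).trans ?_
    rw [pow_two, mul_assoc]
    gcongr
    exact hadj _
  have hyy : ‖(2 * D.ε₀ * D.c₃) • (yn - yo)‖ = 2 * D.ε₀ * D.c₃ * ‖yn - yo‖ := by
    rw [norm_smul, Real.norm_eq_abs, abs_of_nonneg (by positivity)]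
  have hgy : ‖gradient D.h yn + D.B.adjoint (zn + D.α • D.residual xn yn) +
      (2 * D.ε₀ * D.c₃) • (yn - yo)‖ ≤
      ‖D.B‖ * ‖zn - zo‖ + ‖D.P‖ * ‖yn - yo‖ + 2 * D.ε₀ * D.c₃ * ‖yn - yo‖ := by
    have e : gradient D.h yn + D.B.adjoint (zn + D.α • D.residual xn yn) =
        D.B.adjoint (zn - zo) - D.P (yn - yo) := by
      rw [eq_neg_of_add_eq_zero_left hgrad]
      simp only [map_add, map_sub]
      abel
    rw [e]
    refine (norm_add_le _ _).trans (add_le_add ((norm_sub_le _ _).trans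
      (add_le_add (hadj _) (D.P.le_opNorm _))) hyy.le)
  have hrz : ‖D.residual xn yn‖ = 1 / (D.α * D.β) * ‖zn - zo‖ := by
    rw [hz, add_sub_cancel_left, norm_smul, Real.norm_eq_abs, abs_of_pos (by positivity)]
    field_simp
  have hgz : ‖D.residual xn yn + (2 * D.ε₀ * D.c₅) • D.B (D.B.adjoint (zn - zo))‖ ≤
      1 / (D.α * D.β) * ‖zn - zo‖ + 2 * D.ε₀ * D.c₅ * (‖D.B‖ ^ 2 * ‖zn - zo‖) :=
    (norm_add_le _ _).trans (add_le_add hrz.le hBB)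
  set X := ∑ i, ‖xn i - xo i‖ with hX
  set a := ∑ i, ‖D.A i‖ with ha
  have hX0 : 0 ≤ X := by positivity
  have ha0 : 0 ≤ a := by positivity
  have s1 : ∑ j, ‖D.A j‖ * ‖xn j - xo j‖ ≤ a * X :=
    sum_mul_le_sum_mul_sum _ (fun _ _ => norm_nonneg _) fun _ _ => norm_nonneg _
  have s2 : ∑ j, ‖D.Q j‖ * ‖xn j - xo j‖ ≤ (∑ j, ‖D.Q j‖) * X :=
    sum_mul_le_sum_mul_sum _ (fun _ _ => norm_nonneg _) fun _ _ => norm_nonneg _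
  have hgx : ∑ i, ‖D.blockSubgrad xn xo yo zo i +
      (D.A i).adjoint (zn + D.α • D.residual xn yn)‖ ≤ a * ‖zn - zo‖ +
      D.α * a * (a * X + ‖D.B‖ * ‖yn - yo‖) + (∑ j, ‖D.Q j‖) * X := by
    refine (Finset.sum_le_sum fun i _ =>
      norm_block_component_le hα xn xo yn yo zn zo i).trans ?_
    rw [Finset.sum_add_distrib, Finset.sum_add_distrib, ← Finset.sum_mul, ← Finset.sum_mul,
      ← Finset.mul_sum]
    gcongr
  have r1 : ∑ i, ‖D.Q i‖ + D.α * a ^ 2 ≤ D.rhoTilde := le_max_left _ _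
  have r2 : ‖D.P‖ + D.α * a * ‖D.B‖ + 4 * D.ε₀ * D.c₃ ≤ D.rhoTilde :=
    (le_max_left _ _).trans (le_max_right _ _)
  have r3 : a + ‖D.B‖ + 4 * D.ε₀ * D.c₅ * ‖D.B‖ ^ 2 + 1 / (D.α * D.β) ≤ D.rhoTilde :=
    (le_max_right _ _).trans (le_max_right _ _)
  have t1 := mul_le_mul_of_nonneg_right r1 hX0
  have t2 := mul_le_mul_of_nonneg_right r2 (norm_nonneg (yn - yo))
  have t3 := mul_le_mul_of_nonneg_right r3 (norm_nonneg (zn - zo))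
  have hq := norm_quintuple_le (WithLp.toLp 2 fun i => D.blockSubgrad xn xo yo zo i +
      (D.A i).adjoint (zn + D.α • D.residual xn yn) : Blocks n)
    (gradient D.h yn + D.B.adjoint (zn + D.α • D.residual xn yn) +
      (2 * D.ε₀ * D.c₃) • (yn - yo))
    (D.residual xn yn + (2 * D.ε₀ * D.c₅) • D.B (D.B.adjoint (zn - zo)))
    (-((2 * D.ε₀ * D.c₃) • (yn - yo)))
    (-((2 * D.ε₀ * D.c₅) • D.B (D.B.adjoint (zn - zo))))
  rw [norm_neg, norm_neg, hyy] at hq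
  refine (hq : ‖D.LbarSubgrad xn xo yn yo zn zo‖ ≤ _).trans ?_
  simp only
  linarith

theorem rhoTilde_pos (hS : D.Standing) : 0 < D.rhoTilde := by
  have hα := hS.α_pos
  have hβ := hS.β_pos
  have hε : 0 < D.ε₀ := zero_lt_one.trans hS.ε₀_gt_one
  have hc5 := c₅_nonneg hS
  refine lt_of_lt_of_le ?_ ((le_max_right _ _).trans (le_max_right _ _))
  have : 0 < 1 / (D.α * D.β) := by positivity
  positivity

theorem infEDist_limitingSubdiff_le (hS : D.Standing) (h1 : D.A1) (h2 : D.A2)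
    {x : ℕ → Blocks n} {y : ℕ → Eu q} {z : ℕ → Eu m} (hit : D.IsIteration x y z) (k : ℕ) :
    Metric.infEDist 0 (limitingSubdiff D.Lbar
      (quintuple (x (k + 1)) (y (k + 1)) (z (k + 1)) (y k) (z k))) ≤
      ENNReal.ofReal (D.rhoTilde * Real.sqrt ((p : ℝ) + 2) *
        ‖triple (x (k + 1)) (y (k + 1)) (z (k + 1)) - triple (x k) (y k) (z k)‖) := by
  have hmem := frechetSubdiff_subset_limitingSubdiff _ _
    (LbarSubgrad_mem hS h1 h2 (yn := y (k + 1)) (zn := z (k + 1)) (hit.x_step k))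
  refine (Metric.infEDist_le_edist_of_mem hmem).trans ?_
  rw [edist_dist, dist_zero_left]
  refine ENNReal.ofReal_le_ofReal ((norm_LbarSubgrad_le hS
    (y_step_gradient hS h1 h2 (finite_iterate hS h1 hit k) (hit.y_step k)) (hit.z_step k)).trans ?_)
  rw [mul_assoc]
  refine mul_le_mul_of_nonneg_left ?_ (rhoTilde_pos hS).le
  rw [triple_sub]
  exact sum_norm_le_sqrt_mul_norm_triple (x (k + 1) - x k) _ _

end Data

/-! ### The KL argument for abstract sequences -/

namespace Desingularizing

variable {η : ℝ} {ψ : ℝ → ℝ}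

/-- The tangent inequality for a concave desingularizing function. -/
theorem le_tangent (h : Desingularizing η ψ) {s t : ℝ} (hs : 0 ≤ s) (ht : 0 < t) (htη : t < η)
    (hst : s ≤ t) : ψ s ≤ ψ t + deriv ψ t * (s - t) := by
  rcases hst.eq_or_lt with rfl | hlt
  · simp
  have hd : HasDerivAt ψ (deriv ψ t) t :=
    ((h.contDiffOn.differentiableOn one_ne_zero).differentiableAt
      (Ioo_mem_nhds ht htη)).hasDerivAt
  have h1 := h.concaveOn.le_slope_of_hasDerivAt ⟨hs, hlt.trans htη⟩ ⟨ht.le, htη⟩ hlt hd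
  rw [slope_def_field, le_div_iff₀ (sub_pos.2 hlt)] at h1
  linarith

theorem monotoneOn (h : Desingularizing η ψ) : MonotoneOn ψ (Set.Ico 0 η) := by
  intro s hs t ht hst
  rcases ht.1.eq_or_lt with h0 | h0
  · rw [le_antisymm (h0 ▸ hst) hs.1, ← h0]
  · have h1 := h.le_tangent hs.1 h0 ht.2 hst
    have h2 := (h.deriv_pos t ⟨h0, ht.2⟩).le
    nlinarith

theorem tendsto_zero (h : Desingularizing η ψ) {e : ℕ → ℝ} (he : ∀ k, 0 ≤ e k)
    (hlim : Filter.Tendsto e Filter.atTop (nhds 0)) :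
    Filter.Tendsto (fun k => ψ (e k)) Filter.atTop (nhds 0) := by
  have hc := h.continuousOn 0 ⟨le_rfl, h.eta_pos⟩
  rw [ContinuousWithinAt, h.zero] at hc
  refine hc.comp (tendsto_nhdsWithin_iff.2 ⟨hlim, ?_⟩)
  filter_upwards [hlim.eventually (gt_mem_nhds h.eta_pos)] with k hk
  exact ⟨he k, hk⟩

end Desingularizing

section KL

variable {E : Type*} [NormedAddCommGroup E] {u : ℕ → E} {us : E} {e : ℕ → ℝ} {σ ρ r η : ℝ}
  {ψ : ℝ → ℝ}

/-- `e k` is the value at `u (k + 1)`. With d, d' the consecutive steps and T the drop of ψ,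
concavity, decrease and KL give σd'² ≤ ρdT, and 2√(ab) ≤ a + b finishes. If `e k = 0`, the step d'
vanishes. -/
theorem kl_step (hψ : Desingularizing η ψ) (hσ : 0 < σ) (hρ : 0 < ρ) {k : ℕ}
    (hdesc : e (k + 1) + σ * ‖u (k + 2) - u (k + 1)‖ ^ 2 ≤ e k) (he : ∀ k, 0 ≤ e k)
    (hkη : e k < η) (hKL : 0 < e k → 1 ≤ deriv ψ (e k) * (ρ * ‖u (k + 1) - u k‖)) :
    2 * ‖u (k + 2) - u (k + 1)‖ ≤
      ‖u (k + 1) - u k‖ + ρ / σ * (ψ (e k) - ψ (e (k + 1))) := by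
  set d := ‖u (k + 1) - u k‖ with hd
  set d' := ‖u (k + 2) - u (k + 1)‖ with hd'
  have hd0 : 0 ≤ d := norm_nonneg _
  have hd0' : 0 ≤ d' := norm_nonneg _
  have hsq : 0 ≤ σ * d' ^ 2 := by positivity
  rcases (he k).eq_or_lt with h0 | h0
  · have h1 : e (k + 1) = 0 := le_antisymm (by linarith) (he _)
    have h2 : d' = 0 := by
      have : σ * d' ^ 2 ≤ 0 := by linarith
      have : d' ^ 2 ≤ 0 := nonpos_of_mul_nonpos_right this hσ
      nlinarith
    rw [h1, ← h0, h2]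
    simpa using hd0
  · have hle : e (k + 1) ≤ e k := by linarith
    have ht := hψ.le_tangent (he (k + 1)) h0 hkη hle
    have hg := hψ.deriv_pos _ ⟨h0, hkη⟩
    have hk := hKL h0
    set g := deriv ψ (e k)
    set T := ψ (e k) - ψ (e (k + 1)) with hT
    have hT1 : g * (e k - e (k + 1)) ≤ T := by linarith
    have h3 : e k - e (k + 1) ≤ T * (ρ * d) := by
      calc e k - e (k + 1) ≤ (e k - e (k + 1)) * (g * (ρ * d)) :=
            le_mul_of_one_le_right (by linarith) hk
        _ = g * (e k - e (k + 1)) * (ρ * d) := by ring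
        _ ≤ T * (ρ * d) := by gcongr
    have hT0 : 0 ≤ T := le_trans (mul_nonneg hg.le (by linarith)) hT1
    have h4 : d' ^ 2 ≤ d * (ρ / σ * T) := by
      have : σ * d' ^ 2 ≤ σ * (d * (ρ / σ * T)) := by
        have : σ * (d * (ρ / σ * T)) = T * (ρ * d) := by field_simp
        linarith
      exact le_of_mul_le_mul_left this hσ
    have hT2 : 0 ≤ ρ / σ * T := by positivity
    refine le_of_sq_le_sq ?_ (by positivity)
    nlinarith [sq_nonneg (d - ρ / σ * T)]

/-- Summed form of `kl_step`. KL is required only for i < j, so the bound can be used while the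
iterates are still being shown to stay in the neighbourhood. -/
theorem kl_tail (hψ : Desingularizing η ψ) (hσ : 0 < σ) (hρ : 0 < ρ)
    (hdesc : ∀ k, e (k + 1) + σ * ‖u (k + 2) - u (k + 1)‖ ^ 2 ≤ e k) (he : ∀ k, 0 ≤ e k)
    {K : ℕ} (hη : ∀ k, K ≤ k → e k < η) (j : ℕ)
    (hKL : ∀ i, i < j → 0 < e (K + i) →
      1 ≤ deriv ψ (e (K + i)) * (ρ * ‖u (K + i + 1) - u (K + i)‖)) :
    ‖u (K + j + 1) - u (K + 1)‖ + ‖u (K + j + 1) - u (K + j)‖ + ρ / σ * ψ (e (K + j)) ≤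
      ‖u (K + 1) - u K‖ + ρ / σ * ψ (e K) := by
  induction j with
  | zero => simp
  | succ j ih =>
    have h1 := kl_step hψ hσ hρ (hdesc (K + j)) he (hη _ (by omega)) (hKL j (by omega))
    have h2 := ih fun i hi => hKL i (by omega)
    have h3 := norm_sub_le_norm_sub_add_norm_sub (u (K + j + 2)) (u (K + j + 1)) (u (K + 1))
    have e1 : K + (j + 1) = K + j + 1 := by omega
    rw [e1]
    linarith

/-- Convergence of a descent sequence under the Kurdyka–Łojasiewicz inequality. -/
theorem kl_convergence (hψ : Desingularizing η ψ) (hσ : 0 < σ) (hρ : 0 < ρ) (hr : 0 < r)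
    (hdesc : ∀ k, e (k + 1) + σ * ‖u (k + 2) - u (k + 1)‖ ^ 2 ≤ e k) (he : ∀ k, 0 ≤ e k)
    (hlim : Filter.Tendsto e Filter.atTop (nhds 0)) (hcl : MapClusterPt us Filter.atTop u)
    (hKL : ∀ k, ‖u (k + 1) - us‖ < r → ‖u k - us‖ < r → 0 < e k → e k < η →
      1 ≤ deriv ψ (e k) * (ρ * ‖u (k + 1) - u k‖)) :
    Filter.Tendsto u Filter.atTop (nhds us) ∧ ∃ K, (∀ k, K ≤ k → e k < η) ∧
      (∀ k, K ≤ k → 0 < e k → 1 ≤ deriv ψ (e k) * (ρ * ‖u (k + 1) - u k‖)) ∧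
      ∀ k, K ≤ k → ‖u (k + 1) - us‖ ≤ ‖u (k + 1) - u k‖ + ρ / σ * ψ (e k) := by
  have hd : Filter.Tendsto (fun k => ‖u (k + 1) - u k‖) Filter.atTop (nhds 0) := by
    rw [← Filter.tendsto_add_atTop_iff_nat 1]
    have h1 : Filter.Tendsto (fun k => Real.sqrt (e k / σ)) Filter.atTop (nhds 0) := by
      have := (hlim.div_const σ).sqrt
      simpa using this
    refine squeeze_zero (fun _ => norm_nonneg _) (fun k => ?_) h1
    refine Real.le_sqrt_of_sq_le ?_
    rw [le_div_iff₀ hσ]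
    have := hdesc k
    have := he (k + 1)
    linarith
  have hT : Filter.Tendsto (fun k => ‖u (k + 1) - u k‖ + ρ / σ * ψ (e k)) Filter.atTop
      (nhds 0) := by
    have := hd.add ((hψ.tendsto_zero he hlim).const_mul (ρ / σ))
    simpa using this
  -- Three quantities below r/4 are added later: the distance of `u K` to the limit, the step at K,
  -- and that step plus the ψ-term.
  have hr4 : 0 < r / 4 := by positivity
  obtain ⟨N, hN⟩ := Filter.eventually_atTop.1 ((hd.eventually (gt_mem_nhds hr4)).and
    ((hT.eventually (gt_mem_nhds hr4)).and (hlim.eventually (gt_mem_nhds hψ.eta_pos))))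
  have hfreq := mapClusterPt_iff_frequently.1 hcl
  obtain ⟨K, hKN, hK⟩ := Filter.frequently_atTop.1 (hfreq _ (Metric.ball_mem_nhds us hr4)) N
  rw [Metric.mem_ball, dist_eq_norm] at hK
  have hη : ∀ k, K ≤ k → e k < η := fun k hk => (hN k (hKN.trans hk)).2.2
  have hψ0 : ∀ k, K ≤ k → 0 ≤ ρ / σ * ψ (e k) := fun k hk =>
    mul_nonneg (by positivity) (hψ.nonneg _ ⟨he k, hη k hk⟩)
  -- Strong induction: KL at the indices before K + j confines `u (K + j + 1)` to the ball through
  -- `kl_tail`.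
  have hball : ∀ j, ‖u (K + j) - us‖ < r ∧ ‖u (K + j + 1) - us‖ < r := by
    intro j
    induction j using Nat.strong_induction_on with
    | _ j ih =>
      have h1 := kl_tail hψ hσ hρ hdesc he hη j fun i hi h0 =>
        hKL (K + i) (ih i hi).2 (ih i hi).1 h0 (hη _ (by omega))
      have h2 := norm_sub_le_norm_sub_add_norm_sub (u (K + j + 1)) (u (K + 1)) us
      have h3 := norm_sub_le_norm_sub_add_norm_sub (u (K + 1)) (u K) us
      have h4 := (hN K hKN).1
      have h5 := (hN K hKN).2.1
      have h6 := hψ0 (K + j) (by omega)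
      have h7 : ‖u (K + j + 1) - us‖ < r := by
        have := norm_nonneg (u (K + j + 1) - u (K + j))
        linarith
      refine ⟨?_, h7⟩
      cases j with
      | zero => simpa using hK.trans (by linarith)
      | succ j => exact (ih j (by omega)).2
  have hKL' : ∀ k, K ≤ k → 0 < e k → 1 ≤ deriv ψ (e k) * (ρ * ‖u (k + 1) - u k‖) := by
    intro k hk h0
    obtain ⟨j, rfl⟩ := Nat.exists_eq_add_of_le hk
    exact hKL _ (hball j).2 (hball j).1 h0 (hη _ hk)
  have hbound : ∀ k, K ≤ k → ‖u (k + 1) - us‖ ≤ ‖u (k + 1) - u k‖ + ρ / σ * ψ (e k) := by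
    intro k hk
    -- Compare with a later iterate within ε of the cluster point. Convergence of the whole sequence
    -- then follows from the bound itself, without a Cauchy argument.
    refine le_of_forall_pos_le_add fun ε hε => ?_
    obtain ⟨l, hl, hlε⟩ :=
      Filter.frequently_atTop.1 (hfreq _ (Metric.ball_mem_nhds us hε)) (k + 1)
    obtain ⟨j, rfl⟩ := Nat.exists_eq_add_of_le hl
    rw [Metric.mem_ball, dist_eq_norm] at hlε
    have h1 := kl_tail (K := k) hψ hσ hρ hdesc he (fun i hi => hη i (hk.trans hi)) j
      fun i _ => hKL' _ (by omega)
    have e1 : k + j + 1 = k + 1 + j := by omega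
    rw [e1] at h1
    have h2 := norm_sub_le_norm_sub_add_norm_sub (u (k + 1)) (u (k + 1 + j)) us
    rw [norm_sub_rev (u (k + 1)) (u (k + 1 + j))] at h2
    have h3 := hψ0 (k + j) (by omega)
    have := norm_nonneg (u (k + 1 + j) - u (k + j))
    linarith
  refine ⟨?_, K, hη, hKL', hbound⟩
  rw [tendsto_iff_norm_sub_tendsto_zero, ← Filter.tendsto_add_atTop_iff_nat 1]
  refine squeeze_zero' (Filter.Eventually.of_forall fun _ => norm_nonneg _) ?_ hT
  filter_upwards [Filter.eventually_ge_atTop K] with k hk using hbound k hk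

end KL

/-! ### Rates for the scalar recurrence -/

section Rates

variable {M E : ℕ → ℝ} {c a θ : ℝ}

theorem antitone_of_recurrence (ha : 0 < a) (hE : ∀ j, 0 ≤ E j)
    (hrec : ∀ j, 0 < E (j + 1) → E (j + 1) + a * E (j + 1) ^ (2 * θ) ≤ E j) : Antitone E := by
  refine antitone_nat_of_succ_le fun j => ?_
  rcases (hE (j + 1)).eq_or_lt with h | h
  · rw [← h]; exact hE j
  · have := hrec j h
    have : 0 ≤ a * E (j + 1) ^ (2 * θ) := by positivity
    linarith

theorem eventually_zero_of_recurrence (ha : 0 < a) (hE : ∀ j, 0 ≤ E j)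
    (hlim : Filter.Tendsto E Filter.atTop (nhds 0))
    (hrec : ∀ j, 0 < E (j + 1) → E (j + 1) + a ≤ E j) : ∃ J, ∀ j, J ≤ j → E (j + 1) = 0 := by
  obtain ⟨J, hJ⟩ := Filter.eventually_atTop.1 (hlim.eventually (gt_mem_nhds ha))
  refine ⟨J, fun j hj => ?_⟩
  by_contra hne
  have h0 := lt_of_le_of_ne (hE (j + 1)) (Ne.symm hne)
  have := hrec j h0
  have := hJ j hj
  linarith

/-- As 2θ - 1 ≤ 0 and E decreases, E(j)^(2θ) ≥ E(j)·E(1)^(2θ-1) for positive E(j) with j ≥ 1, so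
each step from index 1 on contracts by 1/Q. If E 1 = 0, every M j vanishes by `hz`. -/
theorem linear_rate (hc : 0 < c) (ha : 0 < a) (hθ : θ ≤ 1 / 2) (hE : ∀ j, 0 ≤ E j)
    (hrec : ∀ j, 0 < E (j + 1) → E (j + 1) + a * E (j + 1) ^ (2 * θ) ≤ E j)
    (hM : ∀ j, M j ≤ c * max (E j ^ (1 - θ)) (Real.sqrt (E j)))
    (hz : ∀ j, E (j + 1) = 0 → M j = 0) :
    (∃ C : ℝ, 0 < C ∧ ∀ j, M j ≤
      C * Real.sqrt (E 1) / Real.sqrt (1 + a * E 1 ^ (2 * θ - 1)) ^ j) ∧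
    ∃ C r : ℝ, 0 < C ∧ 0 < r ∧ r < 1 ∧ ∀ j, M j ≤ C * r ^ j := by
  have hanti := antitone_of_recurrence ha hE hrec
  rcases (hE 1).eq_or_lt with h0 | h0
  · have hzero : ∀ j, M j = 0 := fun j =>
      hz j (le_antisymm (h0 ▸ hanti (Nat.succ_le_succ (Nat.zero_le j))) (hE _))
    refine ⟨⟨1, one_pos, fun j => ?_⟩, 1, 1 / 2, one_pos, by norm_num, by norm_num, fun j => ?_⟩
    · rw [hzero]; positivity
    · rw [hzero]; positivity
  set Q := 1 + a * E 1 ^ (2 * θ - 1) with hQ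
  have hQ1 : 1 < Q := by
    have : 0 < a * E 1 ^ (2 * θ - 1) := by positivity
    linarith
  have hQ0 : 0 < Q := by linarith
  have hstep : ∀ j, E (j + 2) * Q ≤ E (j + 1) := by
    intro j
    rcases (hE (j + 2)).eq_or_lt with h | h
    · rw [← h, zero_mul]; exact hE _
    · have h1 := hrec (j + 1) h
      have h2 : E 1 ^ (2 * θ - 1) ≤ E (j + 2) ^ (2 * θ - 1) :=
        Real.rpow_le_rpow_of_nonpos h (hanti (by omega)) (by linarith)
      have h3 : E (j + 2) ^ (2 * θ) = E (j + 2) * E (j + 2) ^ (2 * θ - 1) := by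
        rw [Real.rpow_sub_one h.ne']; field_simp
      have h4 : E (j + 2) * (a * E 1 ^ (2 * θ - 1)) ≤ E (j + 2) * (a * E (j + 2) ^ (2 * θ - 1)) := by
        gcongr
      rw [h3] at h1
      rw [hQ]
      linarith
  have hgeo : ∀ j, Real.sqrt (E (j + 1)) * Real.sqrt Q ^ j ≤ Real.sqrt (E 1) := by
    intro j
    induction j with
    | zero => simp
    | succ j ih =>
      have h1 := Real.sqrt_le_sqrt (hstep j)
      rw [Real.sqrt_mul (hE _)] at h1
      refine le_trans ?_ ih
      rw [pow_succ']
      calc _ = Real.sqrt (E (j + 2)) * Real.sqrt Q * Real.sqrt Q ^ j := by ring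
        _ ≤ _ := by gcongr
  have hsQ : 0 < Real.sqrt Q := Real.sqrt_pos.2 hQ0
  have hs1 : 0 < Real.sqrt (E 1) := Real.sqrt_pos.2 h0
  -- This bounds E^(1/2-θ) along the sequence, so E^(1-θ) ≤ B√E.
  set B := max 1 (E 0 ^ (1 / 2 - θ)) with hB
  have hB1 : 1 ≤ B := le_max_left _ _
  have hB0 : 0 < B := by linarith
  have hMs : ∀ j, M j ≤ c * B * Real.sqrt (E j) := by
    intro j
    refine (hM j).trans ?_
    rw [mul_assoc]
    gcongr
    refine max_le ?_ (le_mul_of_one_le_left (Real.sqrt_nonneg _) hB1)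
    have h1 : E j ^ (1 - θ) = E j ^ (1 / 2 - θ) * Real.sqrt (E j) := by
      rw [Real.sqrt_eq_rpow, ← Real.rpow_add_of_nonneg (hE j) (by linarith) (by norm_num)]
      congr 1; ring
    rw [h1]
    gcongr
    exact (Real.rpow_le_rpow (hE j) (hanti (Nat.zero_le j)) (by linarith)).trans (le_max_right _ _)
  -- The first summand covers j = 0, where only E 0 bounds M; the second covers j ≥ 1, where the
  -- decay of E lags one power of √Q behind.
  set C := c * B * (Real.sqrt (E 0) / Real.sqrt (E 1) + Real.sqrt Q) with hC
  have hC0 : 0 < C := by positivity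
  have hfirst : ∀ j, M j ≤ C * Real.sqrt (E 1) / Real.sqrt Q ^ j := by
    intro j
    rw [le_div_iff₀ (by positivity)]
    have hCe : C * Real.sqrt (E 1) = c * B * Real.sqrt (E 0) +
        c * B * Real.sqrt Q * Real.sqrt (E 1) := by
      rw [hC]; field_simp
    rw [hCe]
    cases j with
    | zero =>
      rw [pow_zero, mul_one]
      have := hMs 0
      have : 0 ≤ c * B * Real.sqrt Q * Real.sqrt (E 1) := by positivity
      linarith
    | succ j =>
      have h1 : M (j + 1) * Real.sqrt Q ^ (j + 1) ≤
          c * B * Real.sqrt (E (j + 1)) * Real.sqrt Q ^ (j + 1) := by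
        gcongr; exact hMs _
      have h2 : c * B * Real.sqrt (E (j + 1)) * Real.sqrt Q ^ (j + 1) =
          c * B * Real.sqrt Q * (Real.sqrt (E (j + 1)) * Real.sqrt Q ^ j) := by ring
      have h3 : c * B * Real.sqrt Q * (Real.sqrt (E (j + 1)) * Real.sqrt Q ^ j) ≤
          c * B * Real.sqrt Q * Real.sqrt (E 1) := by
        gcongr; exact hgeo j
      have : 0 ≤ c * B * Real.sqrt (E 0) := by positivity
      linarith
  refine ⟨⟨C, hC0, hfirst⟩, C * Real.sqrt (E 1), (Real.sqrt Q)⁻¹, by positivity, by positivity,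
    inv_lt_one_of_one_lt₀ ?_, fun j => ?_⟩
  · rw [Real.lt_sqrt zero_le_one]; simpa using hQ1
  · rw [inv_pow, ← div_eq_mul_inv]
    exact hfirst j

/-- With y = a x^s, w ≥ x(1 + y). Bernoulli's inequality for the exponent s ≤ 1 gives (1 + y)^(-s) ≤
1 - s y/(1 + y), and x^(-s) y = a. Thus E^(-s) grows at least linearly under the recurrence. -/
theorem rpow_neg_growth {s x w : ℝ} (hs0 : 0 < s) (hs1 : s ≤ 1) (ha : 0 < a) (hx : 0 < x)
    (hrec : x + a * x ^ (1 + s) ≤ w) :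
    w ^ (-s) + s * a / (1 + a * x ^ s) ≤ x ^ (-s) := by
  set y := a * x ^ s with hy
  have hy0 : 0 < y := by positivity
  have hw : x * (1 + y) ≤ w := by
    refine le_trans (le_of_eq ?_) hrec
    rw [Real.rpow_add hx, Real.rpow_one]; ring
  have h1 : w ^ (-s) ≤ (x * (1 + y)) ^ (-s) :=
    Real.rpow_le_rpow_of_nonpos (by positivity) hw (by linarith)
  rw [Real.mul_rpow hx.le (by positivity)] at h1
  have h2 : (1 + y) ^ (-s) ≤ 1 - s * (y / (1 + y)) := by
    have h3 : (1 + y) ^ (-s) = (1 + -(y / (1 + y))) ^ s := by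
      rw [Real.rpow_neg (by positivity), ← Real.inv_rpow (by positivity)]
      congr 1; field_simp; ring
    rw [h3]
    refine (rpow_one_add_le_one_add_mul_self ?_ hs0.le hs1).trans (le_of_eq (by ring))
    rw [neg_le_neg_iff, div_le_one (by positivity)]
    linarith
  have h4 : x ^ (-s) * (s * (y / (1 + y))) = s * a / (1 + y) := by
    have : x ^ (-s) * x ^ s = 1 := by rw [← Real.rpow_add hx]; simp
    calc _ = (x ^ (-s) * x ^ s) * (s * a / (1 + y)) := by rw [hy]; ring
      _ = _ := by rw [this, one_mul]
  have h5 : x ^ (-s) * (1 + y) ^ (-s) ≤ x ^ (-s) * (1 - s * (y / (1 + y))) := by gcongr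
  linarith

theorem sublinear_rate (hc : 0 < c) (ha : 0 < a) (hθ : 1 / 2 < θ) (hθ1 : θ < 1)
    (hE : ∀ j, 0 ≤ E j)
    (hrec : ∀ j, 0 < E (j + 1) → E (j + 1) + a * E (j + 1) ^ (2 * θ) ≤ E j)
    (hM : ∀ j, M j ≤ c * max (E j ^ (1 - θ)) (Real.sqrt (E j))) :
    ∃ C μ : ℝ, 0 < C ∧ 0 < μ ∧ ∀ j : ℕ, M j ≤
      C * (μ * j + μ + E 0 ^ (1 - 2 * θ)) ^ (-((1 - θ) / (2 * θ - 1))) := by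
  have hanti := antitone_of_recurrence ha hE hrec
  have hMz : ∀ j, E j = 0 → M j ≤ 0 := by
    intro j hj
    have := hM j
    rw [hj, Real.zero_rpow (by linarith), Real.sqrt_zero, max_self, mul_zero] at this
    exact this
  have hnn : ∀ j, 0 ≤ E j ^ (1 - 2 * θ) := fun j => Real.rpow_nonneg (hE j) _
  rcases (hE 0).eq_or_lt with h0 | h0
  · refine ⟨1, 1, one_pos, one_pos, fun j => (hMz j ?_).trans ?_⟩
    · exact le_antisymm (h0 ▸ hanti (Nat.zero_le j)) (hE j)
    · have := hnn 0
      positivity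
  set s := 2 * θ - 1 with hs
  have hs0 : 0 < s := by linarith
  have hs1 : s ≤ 1 := by linarith
  have e1 : 1 - 2 * θ = -s := by ring
  rw [e1]
  set μ₀ := s * a / (1 + a * E 0 ^ s) with hμ₀
  have hμ₀0 : 0 < μ₀ := by positivity
  have hgrow : ∀ j : ℕ, 0 < E j → E 0 ^ (-s) + μ₀ * j ≤ E j ^ (-s) := by
    intro j
    induction j with
    | zero => intro; simp
    | succ j ih =>
      intro hj
      have hj' : 0 < E j := hj.trans_le (hanti (Nat.le_succ j))
      have h1 := hrec j hj
      have e2 : 2 * θ = 1 + s := by ring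
      rw [e2] at h1
      have h2 := rpow_neg_growth hs0 hs1 ha hj h1
      have h3 : μ₀ ≤ s * a / (1 + a * E (j + 1) ^ s) := by
        rw [hμ₀]
        gcongr
        exact hanti (Nat.zero_le _)
      have := ih hj'
      push_cast
      linarith
  set F := E 0 ^ (-s) with hF
  have hF0 : 0 < F := by positivity
  set γ := (1 - θ) / s with hγ
  have hγ0 : 0 < γ := div_pos (by linarith) hs0
  set B := max 1 (E 0 ^ (θ - 1 / 2)) with hB
  have hB1 : 1 ≤ B := le_max_left _ _
  have hB0 : 0 < B := by linarith
  -- With μ ≤ μ₀ and μ ≤ F, μj + μ + F ≤ 2(μ₀j + F); the 2 becomes the factor 2^γ.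
  refine ⟨c * B * 2 ^ γ, min μ₀ F, by positivity, lt_min hμ₀0 hF0, fun j => ?_⟩
  set μ := min μ₀ F with hμ
  have hμ0 : 0 < μ := lt_min hμ₀0 hF0
  have hT : 0 < μ * j + μ + F := by positivity
  rcases (hE j).eq_or_lt with hj | hj
  · exact (hMz j hj.symm).trans (by positivity)
  have h1 : E j ^ (1 - θ) ≤ 2 ^ γ * (μ * j + μ + F) ^ (-γ) := by
    have h2 : E j ^ (1 - θ) = (E j ^ (-s)) ^ (-γ) := by
      rw [← Real.rpow_mul hj.le]
      congr 1
      rw [hγ]; field_simp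
    have h3 : (μ * j + μ + F) / 2 ≤ E j ^ (-s) := by
      refine le_trans ?_ (hgrow j hj)
      have h4 : μ * j ≤ μ₀ * j := by gcongr; exact min_le_left _ _
      have h5 : μ ≤ F := min_le_right _ _
      have h6 : 0 ≤ μ₀ * j := by positivity
      linarith
    have h4 : 2 ^ γ * (μ * j + μ + F) ^ (-γ) = ((μ * j + μ + F) / 2) ^ (-γ) := by
      rw [Real.div_rpow hT.le zero_le_two, Real.rpow_neg zero_le_two, div_inv_eq_mul, mul_comm]
    rw [h2, h4]
    exact Real.rpow_le_rpow_of_nonpos (by positivity) h3 (by linarith)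
  have h2 : max (E j ^ (1 - θ)) (Real.sqrt (E j)) ≤ B * E j ^ (1 - θ) := by
    refine max_le (le_mul_of_one_le_left (by positivity) hB1) ?_
    have h3 : Real.sqrt (E j) = E j ^ (θ - 1 / 2) * E j ^ (1 - θ) := by
      rw [Real.sqrt_eq_rpow, ← Real.rpow_add hj]
      congr 1; ring
    rw [h3]
    gcongr
    exact (Real.rpow_le_rpow hj.le (hanti (Nat.zero_le j)) (by linarith)).trans (le_max_right _ _)
  calc M j ≤ c * (B * E j ^ (1 - θ)) := (hM j).trans (by gcongr)
    _ ≤ c * (B * (2 ^ γ * (μ * j + μ + F) ^ (-γ))) := by gcongr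
    _ = _ := by ring

theorem rpow_affine_le {γ μ F : ℝ} (hγ : 0 ≤ γ) (hμ : 0 < μ) (hF : 0 ≤ F) (k₀ : ℕ) (j : ℕ)
    (hk : 0 < k₀ + j) : (μ * j + μ + F) ^ (-γ) ≤
      (μ / (k₀ + 1)) ^ (-γ) * ((k₀ + j : ℕ) : ℝ) ^ (-γ) := by
  have hk' : (0 : ℝ) < ((k₀ + j : ℕ) : ℝ) := by exact_mod_cast hk
  rw [← Real.mul_rpow (by positivity) hk'.le]
  refine Real.rpow_le_rpow_of_nonpos (by positivity) ?_ (by linarith)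
  rw [div_mul_eq_mul_div, div_le_iff₀ (by positivity)]
  push_cast
  have : 0 ≤ (j : ℝ) * k₀ := by positivity
  nlinarith [mul_nonneg hF (by positivity : (0 : ℝ) ≤ (k₀ : ℝ) + 1), mul_nonneg hμ.le this]

end Rates

/-! ### Error bound and recurrence from the KL inequality -/

section KL

variable {E : Type*} [NormedAddCommGroup E] {u : ℕ → E} {us : E} {e : ℕ → ℝ} {σ ρ η θ : ℝ}
  {ψ : ℝ → ℝ}

theorem kl_error_bound (hψ : Desingularizing η ψ) (hσ : 0 < σ) (hρ : 0 < ρ)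
    (hdesc : ∀ k, e (k + 1) + σ * ‖u (k + 2) - u (k + 1)‖ ^ 2 ≤ e k) (he : ∀ k, 0 ≤ e k) {k : ℕ}
    (hη : e k < η)
    (hb : ‖u (k + 2) - us‖ ≤ ‖u (k + 2) - u (k + 1)‖ + ρ / σ * ψ (e (k + 1))) :
    ‖u (k + 2) - us‖ ≤ (1 / Real.sqrt σ + ρ / σ) * max (ψ (e k)) (Real.sqrt (e k)) := by
  have hle : e (k + 1) ≤ e k := by
    have := hdesc k
    have : 0 ≤ σ * ‖u (k + 2) - u (k + 1)‖ ^ 2 := by positivity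
    linarith
  have h1 : ‖u (k + 2) - u (k + 1)‖ ≤ 1 / Real.sqrt σ * Real.sqrt (e k) := by
    rw [one_div_mul_eq_div, ← Real.sqrt_div (he k)]
    refine Real.le_sqrt_of_sq_le ?_
    rw [le_div_iff₀ hσ]
    have := hdesc k
    have := he (k + 1)
    linarith
  have h2 : ψ (e (k + 1)) ≤ ψ (e k) :=
    hψ.monotoneOn ⟨he _, hle.trans_lt hη⟩ ⟨he _, hη⟩ hle
  rw [add_mul]
  refine hb.trans (add_le_add (h1.trans ?_) ?_)
  · gcongr; exact le_max_right _ _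
  · gcongr; exact h2.trans (le_max_left _ _)

theorem kl_eq_limit_of_eq_zero (hψ : Desingularizing η ψ) (hσ : 0 < σ)
    (hdesc : ∀ k, e (k + 1) + σ * ‖u (k + 2) - u (k + 1)‖ ^ 2 ≤ e k) (he : ∀ k, 0 ≤ e k) {k : ℕ}
    (hb : ‖u (k + 2) - us‖ ≤ ‖u (k + 2) - u (k + 1)‖ + ρ / σ * ψ (e (k + 1))) (hz : e k = 0) :
    ‖u (k + 1) - us‖ = 0 := by
  have h1 := hdesc k
  have h2 := he (k + 1)
  have h3 : 0 ≤ σ * ‖u (k + 2) - u (k + 1)‖ ^ 2 := by positivity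
  have h4 : e (k + 1) = 0 := by linarith
  have h5 : σ * ‖u (k + 2) - u (k + 1)‖ ^ 2 = 0 := by linarith
  have h6 : ‖u (k + 2) - u (k + 1)‖ = 0 := by simpa [hσ.ne'] using h5
  rw [h4, hψ.zero, h6, mul_zero, add_zero] at hb
  have h7 : u (k + 2) = us := sub_eq_zero.1 (norm_le_zero_iff.1 hb)
  rw [← h7, norm_sub_rev, h6]

/-- Since ψ'(x) = (1-θ)x^(-θ), KL reads x^θ ≤ (1-θ)ρd; squaring it and inserting it into the
decrease gives the recurrence. -/
theorem kl_recurrence (hσ : 0 < σ) (hρ : 0 < ρ) (hθ1 : θ < 1)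
    (hform : ∀ s ∈ Set.Ico 0 η, ψ s = s ^ (1 - θ))
    (hdesc : ∀ k, e (k + 1) + σ * ‖u (k + 2) - u (k + 1)‖ ^ 2 ≤ e k) {k : ℕ}
    (hη : e (k + 1) < η)
    (hKL : 0 < e (k + 1) → 1 ≤ deriv ψ (e (k + 1)) * (ρ * ‖u (k + 2) - u (k + 1)‖))
    (h0 : 0 < e (k + 1)) :
    e (k + 1) + σ / (ρ ^ 2 * (1 - θ) ^ 2) * e (k + 1) ^ (2 * θ) ≤ e k := by
  set x := e (k + 1) with hx
  set d := ‖u (k + 2) - u (k + 1)‖ with hd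
  have hder : deriv ψ x = (1 - θ) * x ^ (-θ) := by
    have h1 : ψ =ᶠ[nhds x] fun s => s ^ (1 - θ) := by
      filter_upwards [Ioo_mem_nhds h0 hη] with s hs using hform s ⟨hs.1.le, hs.2⟩
    rw [h1.deriv_eq, Real.deriv_rpow_const]
    congr 2
    ring
  have h1 := hKL h0
  rw [hder] at h1
  have hxθ : 0 < x ^ θ := by positivity
  have h2 : x ^ θ ≤ (1 - θ) * (ρ * d) := by
    have h3 : x ^ θ * x ^ (-θ) = 1 := by rw [← Real.rpow_add h0]; simp
    calc x ^ θ = x ^ θ * 1 := (mul_one _).symm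
      _ ≤ x ^ θ * ((1 - θ) * x ^ (-θ) * (ρ * d)) := by gcongr
      _ = (x ^ θ * x ^ (-θ)) * ((1 - θ) * (ρ * d)) := by ring
      _ = _ := by rw [h3, one_mul]
  have h3 : x ^ (2 * θ) ≤ ((1 - θ) * (ρ * d)) ^ 2 := by
    rw [mul_comm, Real.rpow_mul h0.le, Real.rpow_two]
    gcongr
  have h4 : 0 < 1 - θ := by linarith
  have h5 : σ / (ρ ^ 2 * (1 - θ) ^ 2) * x ^ (2 * θ) ≤ σ * d ^ 2 := by
    calc _ ≤ σ / (ρ ^ 2 * (1 - θ) ^ 2) * ((1 - θ) * (ρ * d)) ^ 2 := by gcongr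
      _ = σ * d ^ 2 := by field_simp
  have := hdesc k
  linarith

end KL

/-! ### Convergence of the values at the limit point -/

namespace Data

variable {p : ℕ} {n : Fin p → ℕ} {q m : ℕ} {D : Data n q m}

theorem norm_le_norm_triple (x : Blocks n) (y : Eu q) (z : Eu m) :
    (∀ i, ‖x i‖ ≤ ‖triple x y z‖) ∧ ‖y‖ ≤ ‖triple x y z‖ ∧ ‖z‖ ≤ ‖triple x y z‖ := by
  have h := norm_triple_sq x y z
  have hs : 0 ≤ ∑ i, ‖x i‖ ^ 2 := by positivity
  refine ⟨fun i => ?_, ?_, ?_⟩ <;> refine le_of_sq_le_sq ?_ (norm_nonneg _) <;> rw [h]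
  · have := Finset.single_le_sum (f := fun i => ‖x i‖ ^ 2) (fun i _ => sq_nonneg _)
      (Finset.mem_univ i)
    nlinarith [sq_nonneg ‖y‖, sq_nonneg ‖z‖]
  · nlinarith [sq_nonneg ‖z‖]
  · nlinarith [sq_nonneg ‖y‖]

theorem norm_quintuple_le_triple (x x' : Blocks n) (y y' : Eu q) (z z' : Eu m) :
    ‖quintuple x y z y' z'‖ ≤ ‖triple x y z‖ + ‖triple x' y' z'‖ := by
  have h : ‖quintuple x y z y' z'‖ ^ 2 =
      ∑ i, ‖x i‖ ^ 2 + (‖y‖ ^ 2 + (‖z‖ ^ 2 + (‖y'‖ ^ 2 + ‖z'‖ ^ 2))) := by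
    simp [quintuple, WithLp.prod_norm_sq_eq_of_L2, PiLp.norm_sq_eq_of_L2]
  have h1 := norm_triple_sq x y z
  have h2 := norm_triple_sq x' y' z'
  have hs : 0 ≤ ∑ i, ‖x' i‖ ^ 2 := by positivity
  refine le_of_sq_le_sq ?_ (by positivity)
  have : 0 ≤ ‖triple x y z‖ * ‖triple x' y' z'‖ := by positivity
  rw [h]
  nlinarith

theorem tendsto_triple {l : Filter ℕ} {x : ℕ → Blocks n} {y : ℕ → Eu q} {z : ℕ → Eu m}
    {xs : Blocks n} {ys : Eu q} {zs : Eu m}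
    (h : Filter.Tendsto (fun k => triple (x k) (y k) (z k)) l (nhds (triple xs ys zs))) :
    (∀ i, Filter.Tendsto (fun k => x k i) l (nhds (xs i))) ∧ Filter.Tendsto y l (nhds ys) ∧
      Filter.Tendsto z l (nhds zs) := by
  rw [tendsto_iff_norm_sub_tendsto_zero] at h
  have hb := fun k => norm_le_norm_triple (x k - xs) (y k - ys) (z k - zs)
  refine ⟨fun i => ?_, ?_, ?_⟩ <;> rw [tendsto_iff_norm_sub_tendsto_zero]
  · exact squeeze_zero (fun _ => norm_nonneg _) (fun k => (hb k).1 i) h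
  · exact squeeze_zero (fun _ => norm_nonneg _) (fun k => (hb k).2.1) h
  · exact squeeze_zero (fun _ => norm_nonneg _) (fun k => (hb k).2.2) h

theorem tendsto_residual {l : Filter ℕ} {x : ℕ → Blocks n} {y : ℕ → Eu q}
    {xs : Blocks n} {ys : Eu q} (hx : ∀ i, Filter.Tendsto (fun k => x k i) l (nhds (xs i)))
    (hy : Filter.Tendsto y l (nhds ys)) :
    Filter.Tendsto (fun k => D.residual (x k) (y k)) l (nhds (D.residual xs ys)) := by
  refine ((tendsto_finsetSum _ fun i _ => ?_).add ?_).add_const _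
  · exact ((D.A i).continuous.tendsto _).comp (hx i)
  · exact (D.B.continuous.tendsto _).comp hy

theorem tendsto_smooth (h2 : D.A2) {l : Filter ℕ} {x : ℕ → Blocks n} {y : ℕ → Eu q}
    {z : ℕ → Eu m} {xs : Blocks n} {ys : Eu q} {zs : Eu m}
    (hx : ∀ i, Filter.Tendsto (fun k => x k i) l (nhds (xs i)))
    (hy : Filter.Tendsto y l (nhds ys)) (hz : Filter.Tendsto z l (nhds zs)) :
    Filter.Tendsto (fun k => D.h (y k) + inner ℝ (z k) (D.residual (x k) (y k)) +
      D.α / 2 * ‖D.residual (x k) (y k)‖ ^ 2) l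
      (nhds (D.h ys + inner ℝ zs (D.residual xs ys) + D.α / 2 * ‖D.residual xs ys‖ ^ 2)) := by
  have hr := tendsto_residual (D := D) hx hy
  exact (((h2.differentiable.continuous.tendsto _).comp hy).add (hz.inner hr)).add
    ((hr.norm.pow 2).const_mul _)

theorem tendsto_blockSubgrad {l : Filter ℕ} {xn xo : ℕ → Blocks n} {y : ℕ → Eu q} {z : ℕ → Eu m}
    {xs : Blocks n} {ys : Eu q} {zs : Eu m}
    (hxn : ∀ i, Filter.Tendsto (fun k => xn k i) l (nhds (xs i)))
    (hxo : ∀ i, Filter.Tendsto (fun k => xo k i) l (nhds (xs i)))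
    (hy : Filter.Tendsto y l (nhds ys)) (hz : Filter.Tendsto z l (nhds zs)) (i : Fin p) :
    Filter.Tendsto (fun k => D.blockSubgrad (xn k) (xo k) (y k) (z k) i) l
      (nhds (D.blockSubgrad xs xs ys zs i)) := by
  have hd : ∀ j, Filter.Tendsto (fun k => xn k j - xo k j) l (nhds (xs j - xs j)) :=
    fun j => (hxn j).sub (hxo j)
  simp only [blockSubgrad, residual_sweep_self]
  refine ((((D.A i).adjoint.continuous.tendsto _).comp (hz.add
    (((tendsto_residual hxo hy).add (tendsto_finsetSum _ fun j _ => ?_)).const_smul _))).add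
    (((D.Q i).continuous.tendsto _).comp (hd i))).neg
  split_ifs
  · exact ((D.A j).continuous.tendsto _).comp (hd j)
  · exact tendsto_const_nhds

theorem augR_le_LbarR (hS : D.Standing) (x : ℕ → Blocks n) (y : ℕ → Eu q) (z : ℕ → Eu m)
    (k : ℕ) : D.augR (x (k + 1)) (y (k + 1)) (z (k + 1)) ≤ D.LbarR x y z k := by
  have hε : 0 < D.ε₀ := zero_lt_one.trans hS.ε₀_gt_one
  have hc3 := c₃_nonneg hS
  have hc5 := c₅_nonneg hS
  rw [LbarR, le_add_iff_nonneg_right]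
  positivity

theorem LbarR_antitone (hS : D.Standing) (h1 : D.A1) (h2 : D.A2) (h3 : D.A3) {τ : Fin p → ℝ}
    (hτ : ∀ i, D.IsModulus i (τ i)) (hσ : 0 < D.sigma τ) {x : ℕ → Blocks n} {y : ℕ → Eu q}
    {z : ℕ → Eu m} (hit : D.IsIteration x y z) : Antitone (D.LbarR x y z) := by
  refine antitone_nat_of_succ_le fun k => ?_
  refine le_trans ?_ (descent hS h1 h2 h3 hτ hit k)
  rw [le_add_iff_nonneg_right]
  positivity

/-- Lower semicontinuity bounds the modified Lagrangian along the iteration from below. -/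
theorem le_LbarR_of_cluster (hS : D.Standing) (h1 : D.A1) (h2 : D.A2) {x : ℕ → Blocks n}
    {y : ℕ → Eu q} {z : ℕ → Eu m} (hit : D.IsIteration x y z) (hanti : Antitone (D.LbarR x y z))
    {xs : Blocks n} {ys : Eu q} {zs : Eu m} {l : Filter ℕ} [l.NeBot] (hl : l ≤ Filter.atTop)
    (hlim : Filter.Tendsto (fun k => triple (x k) (y k) (z k)) l (nhds (triple xs ys zs)))
    (hfs : ∀ i, D.f i (xs i) ≠ ⊤) (k : ℕ) : D.augR xs ys zs ≤ D.LbarR x y z k := by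
  obtain ⟨hx, hy, hz⟩ := tendsto_triple hlim
  have hsm := tendsto_smooth h2 hx hy hz
  refine le_of_forall_pos_le_add fun ε hε => ?_
  -- One share of ε for each of the p block functions and one for the smooth part.
  set δ := ε / (p + 1) with hδ
  have hδ0 : 0 < δ := by positivity
  have hf : ∀ i, ∀ᶠ j in l, (((D.f i (xs i)).toReal - δ : ℝ) : EReal) < D.f i (x j i) := by
    intro i
    refine (hx i).eventually (h1.lsc i (xs i) _ ?_)
    have h : (((D.f i (xs i)).toReal - δ : ℝ) : EReal) < ((D.f i (xs i)).toReal : EReal) :=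
      EReal.coe_lt_coe_iff.2 (by linarith)
    rwa [EReal.coe_toReal (hfs i) ((h1.proper i).1 _)] at h
  obtain ⟨j, hj1, hj2, hj3⟩ := ((Filter.eventually_all.2 hf).and
    ((hsm.eventually (lt_mem_nhds (sub_lt_self _ hδ0))).and
      (hl (Filter.eventually_ge_atTop (k + 1))))).exists
  obtain ⟨j, rfl⟩ : ∃ i, j = i + 1 := ⟨j - 1, by omega⟩
  have hfin := finite_iterate hS h1 hit j
  have hsum : ∑ i, ((D.f i (xs i)).toReal - δ) ≤ ∑ i, (D.f i (x (j + 1) i)).toReal := by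
    refine Finset.sum_le_sum fun i _ => ?_
    have h := hj1 i
    rw [← EReal.coe_toReal (hfin i) ((h1.proper i).1 _), EReal.coe_lt_coe_iff] at h
    exact h.le
  rw [Finset.sum_sub_distrib, Finset.sum_const, Finset.card_univ, Fintype.card_fin,
    nsmul_eq_mul] at hsum
  have h3 := augR_le_LbarR hS x y z j
  have h4 := hanti (show k ≤ j by omega)
  have h5 : (p + 1 : ℝ) * δ = ε := by rw [hδ]; field_simp
  simp only [augR] at h3 ⊢
  linarith

/-- Lower semicontinuity gives one inequality. For the other, `f_support` at `xs` bounds f_i at the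
iterates by f_i(xs) up to `err`, which tends to 0 along the ultrafilter: steps vanish, block
subgradients converge and the iterates tend to `xs`. Monotonicity carries the limit to the whole
sequence. -/
theorem LbarR_tendsto (hS : D.Standing) (h1 : D.A1) (h2 : D.A2) (h3 : D.A3) {τ : Fin p → ℝ}
    (hτ : ∀ i, D.IsModulus i (τ i)) (hσ : 0 < D.sigma τ) {x : ℕ → Blocks n}
    {y : ℕ → Eu q} {z : ℕ → Eu m} (hit : D.IsIteration x y z)
    {xs : Blocks n} {ys : Eu q} {zs : Eu m}
    (hcl : MapClusterPt (triple xs ys zs) Filter.atTop (fun k => triple (x k) (y k) (z k)))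
    (hfs : ∀ i, D.f i (xs i) ≠ ⊤) : (∀ k, D.augR xs ys zs ≤ D.LbarR x y z k) ∧
      Filter.Tendsto (D.LbarR x y z) Filter.atTop (nhds (D.augR xs ys zs)) := by
  obtain ⟨U, hU, hlim⟩ := mapClusterPt_iff_ultrafilter.1 hcl
  have hanti := LbarR_antitone hS h1 h2 h3 hτ hσ hit
  have hge := le_LbarR_of_cluster hS h1 h2 hit hanti hU hlim hfs
  refine ⟨hge, ?_⟩
  have hinf := tendsto_atTop_ciInf hanti ⟨_, Set.forall_mem_range.2 hge⟩
  set L := ⨅ k, D.LbarR x y z k with hL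
  have hLge : D.augR xs ys zs ≤ L := le_ciInf hge
  set u := fun k => triple (x k) (y k) (z k) with hu
  have hd : Filter.Tendsto (fun k => ‖u (k + 1) - u k‖) Filter.atTop (nhds 0) := by
    rw [← Filter.tendsto_add_atTop_iff_nat 1]
    have h4 : Filter.Tendsto (fun k => Real.sqrt ((D.LbarR x y z k - L) / D.sigma τ))
        Filter.atTop (nhds 0) := by
      have := ((hinf.sub_const L).div_const (D.sigma τ)).sqrt
      simpa using this
    refine squeeze_zero (fun _ => norm_nonneg _) (fun k => ?_) h4
    refine Real.le_sqrt_of_sq_le ?_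
    rw [le_div_iff₀ hσ]
    have h5 := descent hS h1 h2 h3 hτ hit k
    have h6 : L ≤ D.LbarR x y z (k + 1) := ciInf_le ⟨_, Set.forall_mem_range.2 hge⟩ _
    simp only [hu]
    linarith
  have hlim' : Filter.Tendsto (fun k => u (k + 1)) U (nhds (triple xs ys zs)) := by
    have h4 : Filter.Tendsto (fun k => u (k + 1) - u k) U (nhds 0) :=
      (tendsto_zero_iff_norm_tendsto_zero.2 hd).mono_left hU
    simpa using h4.add hlim
  obtain ⟨hx, hy, hz⟩ := tendsto_triple hlim
  obtain ⟨hx', hy', hz'⟩ := tendsto_triple hlim'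
  have hsm := tendsto_smooth h2 hx' hy' hz'
  set err : ℕ → Fin p → ℝ := fun k i =>
    inner ℝ (D.blockSubgrad (x (k + 1)) (x k) (y k) (z k) i) (xs i - x (k + 1) i) -
      (D.α / 2 * ‖D.A i‖ ^ 2 + 1 / 2 * ‖D.Q i‖) * ‖xs i - x (k + 1) i‖ ^ 2 with herr
  have herr0 : ∀ i, Filter.Tendsto (fun k => err k i) U (nhds 0) := by
    intro i
    have hdx : Filter.Tendsto (fun k => xs i - x (k + 1) i) U (nhds 0) := by
      simpa using (hx' i).const_sub (xs i)
    have h4 := ((tendsto_blockSubgrad (D := D) hx' hx hy hz i).inner hdx).sub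
      ((hdx.norm.pow 2).const_mul (D.α / 2 * ‖D.A i‖ ^ 2 + 1 / 2 * ‖D.Q i‖))
    rwa [inner_zero_right, norm_zero, zero_pow two_ne_zero, mul_zero, sub_zero] at h4
  have hub : ∀ k, D.LbarR x y z k ≤ (∑ i, ((D.f i (xs i)).toReal - err k i)) +
      (D.h (y (k + 1)) + inner ℝ (z (k + 1)) (D.residual (x (k + 1)) (y (k + 1))) +
        D.α / 2 * ‖D.residual (x (k + 1)) (y (k + 1))‖ ^ 2) +
      (D.ε₀ * D.c₅ * ‖D.B.adjoint (z (k + 1) - z k)‖ ^ 2 +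
        D.ε₀ * D.c₃ * ‖y (k + 1) - y k‖ ^ 2) := by
    intro k
    rw [LbarR, augR]
    gcongr with i _
    have h := f_support hS h1 (hit.x_step k i) (xs i)
    rw [← EReal.coe_toReal (finite_iterate hS h1 hit k i) ((h1.proper i).1 _),
      ← EReal.coe_toReal (hfs i) ((h1.proper i).1 _), ← EReal.coe_add, EReal.coe_le_coe_iff] at h
    simp only [herr]
    linarith
  have hdy : Filter.Tendsto (fun k => y (k + 1) - y k) U (nhds 0) := by simpa using hy'.sub hy
  have hdz : Filter.Tendsto (fun k => D.B.adjoint (z (k + 1) - z k)) U (nhds 0) := by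
    have h4 := (D.B.adjoint.continuous.tendsto _).comp (hz'.sub hz)
    simpa [Function.comp_def] using h4
  have hlimub := ((tendsto_finsetSum Finset.univ fun i _ =>
    (herr0 i).const_sub (D.f i (xs i)).toReal).add hsm).add
    (((hdz.norm.pow 2).const_mul (D.ε₀ * D.c₅)).add ((hdy.norm.pow 2).const_mul (D.ε₀ * D.c₃)))
  have hle := le_of_tendsto_of_tendsto' (hinf.mono_left hU) hlimub hub
  have : L = D.augR xs ys zs := by
    refine le_antisymm (hle.trans (le_of_eq ?_)) hLge
    simp [augR]
  rwa [this] at hinf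

end Data
end PADMM

/-! ### The KL inequality along the iteration -/

namespace PADMM.Data

variable {p : ℕ} {n : Fin p → ℕ} {q m : ℕ} {D : Data n q m}

theorem Lbar_limit_eq (h1 : D.A1) {xs : Blocks n} (hfs : ∀ i, D.f i (xs i) ≠ ⊤) (ys : Eu q)
    (zs : Eu m) : D.Lbar (quintuple xs ys zs ys zs) = (D.augR xs ys zs : EReal) := by
  have e : D.Lbar (quintuple xs ys zs ys zs) = D.augL xs ys zs +
    ((D.ε₀ * D.c₅ * ‖D.B.adjoint (zs - zs)‖ ^ 2 + D.ε₀ * D.c₃ * ‖ys - ys‖ ^ 2 : ℝ) : EReal) := rfl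
  rw [e, augL_eq_coe h1 hfs]
  simp

theorem finite_of_Lbar_lt_top (h1 : D.A1) {xs : Blocks n} {ys : Eu q} {zs : Eu m}
    (h : D.Lbar (quintuple xs ys zs ys zs) < ⊤) : ∀ i, D.f i (xs i) ≠ ⊤ := by
  intro i
  refine ereal_ne_top_of_sum_ne_top Finset.univ (g := fun i => D.f i (xs i))
    (fun j _ => (h1.proper j).1 _) (fun ht => ?_) i (Finset.mem_univ i)
  have e : D.Lbar (quintuple xs ys zs ys zs) = ∑ i, D.f i (xs i) + ((_ : ℝ) : EReal) +
    ((_ : ℝ) : EReal) := rfl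
  rw [e, ht, EReal.top_add_coe, EReal.top_add_coe] at h
  exact lt_irrefl _ h

/-- The Kurdyka–Łojasiewicz inequality along the iteration, in terms of the step length. -/
theorem kl_along_iteration (hS : D.Standing) (h1 : D.A1) (h2 : D.A2) {x : ℕ → Blocks n}
    {y : ℕ → Eu q} {z : ℕ → Eu m} (hit : D.IsIteration x y z) {xs : Blocks n} {ys : Eu q}
    {zs : Eu m} {η : ℝ} {ψ : ℝ → ℝ} (hKL : HasKLWith D.Lbar (quintuple xs ys zs ys zs) η ψ)
    (hfs : ∀ i, D.f i (xs i) ≠ ⊤) : ∃ r : ℝ, 0 < r ∧ ∀ k,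
      ‖triple (x (k + 1)) (y (k + 1)) (z (k + 1)) - triple xs ys zs‖ < r →
      ‖triple (x k) (y k) (z k) - triple xs ys zs‖ < r →
      0 < D.LbarR x y z k - D.augR xs ys zs → D.LbarR x y z k - D.augR xs ys zs < η →
      1 ≤ deriv ψ (D.LbarR x y z k - D.augR xs ys zs) *
        (D.rhoTilde * Real.sqrt ((p : ℝ) + 2) *
          ‖triple (x (k + 1)) (y (k + 1)) (z (k + 1)) - triple (x k) (y k) (z k)‖) := by
  obtain ⟨-, hψ, hnhds⟩ := hKL
  obtain ⟨r, hr, hball⟩ := Metric.eventually_nhds_iff.1 hnhds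
  -- A quintuple is controlled by two consecutive triples, each allowed half of the radius.
  refine ⟨r / 2, half_pos hr, fun k hk1 hk0 hpos hlt => ?_⟩
  have hval : D.Lbar (quintuple (x (k + 1)) (y (k + 1)) (z (k + 1)) (y k) (z k)) =
    (D.LbarR x y z k : EReal) := LbarSeq_succ hS h1 hit k
  have hdist : dist (quintuple (x (k + 1)) (y (k + 1)) (z (k + 1)) (y k) (z k))
      (quintuple xs ys zs ys zs) < r := by
    rw [dist_eq_norm]
    have h3 : quintuple (x (k + 1)) (y (k + 1)) (z (k + 1)) (y k) (z k) -
      quintuple xs ys zs ys zs = quintuple (x (k + 1) - xs) (y (k + 1) - ys) (z (k + 1) - zs)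
        (y k - ys) (z k - zs) := rfl
    rw [h3]
    refine (norm_quintuple_le_triple _ (x k - xs) _ _ _ _).trans_lt ?_
    rw [triple_sub] at hk1 hk0
    linarith
  have h3 := hball hdist
  rw [hval, Lbar_limit_eq h1 hfs, EReal.coe_lt_coe_iff, ← EReal.coe_add, EReal.coe_lt_coe_iff,
    EReal.toReal_coe, EReal.toReal_coe] at h3
  have h4 := h3 (by linarith) (by linarith)
  have hg := hψ.deriv_pos _ ⟨hpos, hlt⟩
  have h5 := h4.trans (mul_le_mul_right (infEDist_limitingSubdiff_le hS h1 h2 hit k) _)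
  rwa [← ENNReal.ofReal_mul hg.le, ENNReal.one_le_ofReal] at h5

end PADMM.Data

end

theorem theorem3 {p : ℕ} {n : Fin p → ℕ} {q m : ℕ} (D : PADMM.Data n q m)
    (hS : D.Standing) (h1 : D.A1) (h2 : D.A2) (h3 : D.A3)
    (τ : Fin p → ℝ) (h4 : ∀ i, D.IsModulus i (τ i))
    (hσ : 0 < D.sigma τ)
    (x : ℕ → PADMM.Blocks n) (y : ℕ → PADMM.Eu q) (z : ℕ → PADMM.Eu m)
    (hiter : D.IsIteration x y z)
    (xs : PADMM.Blocks n) (ys : PADMM.Eu q) (zs : PADMM.Eu m)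
    (hlim : MapClusterPt (PADMM.triple xs ys zs) Filter.atTop
      (fun k => PADMM.triple (x k) (y k) (z k)))
    (η : ℝ) (ψ : ℝ → ℝ)
    (hKL : PADMM.HasKLWith D.Lbar (PADMM.quintuple xs ys zs ys zs) η ψ) :
    Filter.Tendsto (fun k => PADMM.triple (x k) (y k) (z k)) Filter.atTop
      (nhds (PADMM.triple xs ys zs)) ∧
    Filter.Tendsto (D.LbarSeq x y z) Filter.atTop
      (nhds (D.Lbar (PADMM.quintuple xs ys zs ys zs))) ∧
    ∃ k₀ : ℕ, 2 ≤ k₀ ∧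
      (∀ k, k₀ ≤ k →
        D.Lbar (PADMM.quintuple xs ys zs ys zs) ≤ D.LbarSeq x y z (k - 1) ∧
        D.LbarSeq x y z (k - 1) < D.Lbar (PADMM.quintuple xs ys zs ys zs) + (η : EReal)) ∧
      (∃ c : ℝ, 0 < c ∧ ∀ k, k₀ ≤ k →
        ‖PADMM.triple (x k) (y k) (z k) - PADMM.triple xs ys zs‖ ≤
          c * max (ψ (D.err x y z xs ys zs (k - 1)))
            (Real.sqrt (D.err x y z xs ys zs (k - 1)))) ∧
      ∀ θ : ℝ, 0 ≤ θ → θ < 1 → (∀ s ∈ Set.Ico 0 η, ψ s = s ^ (1 - θ)) →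
        (θ = 0 → ∃ K : ℕ, ∀ k, K ≤ k →
          PADMM.triple (x k) (y k) (z k) = PADMM.triple xs ys zs) ∧
        (0 < θ → θ ≤ 1 / 2 →
          (∃ c : ℝ, 0 < c ∧ ∀ k, k₀ ≤ k →
            ‖PADMM.triple (x k) (y k) (z k) - PADMM.triple xs ys zs‖ ≤
              c * Real.sqrt (D.err x y z xs ys zs k₀) /
                Real.sqrt (1 + D.alphaBar τ θ *
                  D.err x y z xs ys zs k₀ ^ (2 * θ - 1)) ^ (k - k₀)) ∧
          ∃ c r : ℝ, 0 < c ∧ 0 < r ∧ r < 1 ∧ ∀ k, k₀ ≤ k →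
            ‖PADMM.triple (x k) (y k) (z k) - PADMM.triple xs ys zs‖ ≤ c * r ^ k) ∧
        (1 / 2 < θ →
          (∃ c μ : ℝ, 0 < c ∧ 0 < μ ∧ ∀ k, k₀ ≤ k →
            ‖PADMM.triple (x k) (y k) (z k) - PADMM.triple xs ys zs‖ ≤
              c * (μ * ((k : ℝ) - (k₀ : ℝ)) + μ +
                D.err x y z xs ys zs (k₀ - 1) ^ (1 - 2 * θ)) ^ (-((1 - θ) / (2 * θ - 1)))) ∧
          Asymptotics.IsBigO Filter.atTop
            (fun k => PADMM.triple (x k) (y k) (z k) - PADMM.triple xs ys zs)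
            (fun k : ℕ => (k : ℝ) ^ (-((1 - θ) / (2 * θ - 1))))) := by
  -- A subgradient at v* exists only where L̄ is finite, so every f_i is finite at the limit point.
  obtain ⟨s, hs⟩ := hKL.1
  have hfs := PADMM.Data.finite_of_Lbar_lt_top h1 hs.1
  have hψ := hKL.2.1
  have hsucc := PADMM.Data.LbarSeq_succ hS h1 hiter
  have hLs := PADMM.Data.Lbar_limit_eq h1 hfs ys zs
  obtain ⟨hge, hLlim⟩ := PADMM.Data.LbarR_tendsto hS h1 h2 h3 h4 hσ hiter hlim hfs
  obtain ⟨r, hr, hKLr⟩ := PADMM.Data.kl_along_iteration hS h1 h2 hiter hKL hfs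
  have hρ : 0 < D.rhoTilde * Real.sqrt ((p : ℝ) + 2) :=
    mul_pos (PADMM.Data.rhoTilde_pos hS) (by positivity)
  set u : ℕ → PADMM.Triple n q m := fun k => PADMM.triple (x k) (y k) (z k) with hu
  set us := PADMM.triple xs ys zs with hus
  set ρ := D.rhoTilde * Real.sqrt ((p : ℝ) + 2) with hρdef
  set e : ℕ → ℝ := fun k => D.LbarR x y z k - D.augR xs ys zs with hedef
  have herr : ∀ k, D.err x y z xs ys zs (k + 1) = e k := fun k => by
    rw [PADMM.Data.err, hsucc, hLs, EReal.toReal_coe, EReal.toReal_coe]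
  have hdesc : ∀ k, e (k + 1) + D.sigma τ * ‖u (k + 2) - u (k + 1)‖ ^ 2 ≤ e k := fun k => by
    have := PADMM.Data.descent hS h1 h2 h3 h4 hiter k
    simp only [hedef, hu]
    linarith
  have he : ∀ k, 0 ≤ e k := fun k => sub_nonneg.2 (hge k)
  have hlim0 : Filter.Tendsto e Filter.atTop (nhds 0) := by
    simpa using hLlim.sub_const (D.augR xs ys zs)
  obtain ⟨hconv, K, hη, hKLK, hbound⟩ :=
    PADMM.kl_convergence hψ hσ hρ hr hdesc he hlim0 hlim hKLr
  -- `hbound` at K + j + 1 concerns iterate K + 2 + j; weakening its value to `e (K + j)`, the error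
  -- at the preceding iterate, gives k₀ = K + 2.
  refine ⟨hconv, ?_, K + 2, by omega, ?_, ?_, ?_⟩
  · rw [← Filter.tendsto_add_atTop_iff_nat 1]
    simp only [hsucc, hLs]
    exact (continuous_coe_real_ereal.tendsto _).comp hLlim
  · intro k hk
    obtain ⟨j, rfl⟩ := Nat.exists_eq_add_of_le hk
    have hj : K + 2 + j - 1 = K + j + 1 := by omega
    rw [hj, hsucc, hLs, ← EReal.coe_add, EReal.coe_le_coe_iff, EReal.coe_lt_coe_iff]
    have h5 : e (K + j) < η := hη _ (by omega)
    simp only [hedef] at h5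
    exact ⟨hge _, by linarith⟩
  all_goals
    have hc : 0 < 1 / Real.sqrt (D.sigma τ) + ρ / D.sigma τ := by positivity
    have hM : ∀ j, ‖u (K + 2 + j) - us‖ ≤ (1 / Real.sqrt (D.sigma τ) + ρ / D.sigma τ) *
        max (ψ (e (K + j))) (Real.sqrt (e (K + j))) := fun j => by
      have h5 := PADMM.kl_error_bound hψ hσ hρ hdesc he (hη (K + j) (by omega))
        (hbound (K + j + 1) (by omega))
      rwa [show K + 2 + j = K + j + 2 by omega]
  · refine ⟨_, hc, fun k hk => ?_⟩
    obtain ⟨j, rfl⟩ := Nat.exists_eq_add_of_le hk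
    rw [show K + 2 + j - 1 = K + j + 1 by omega, herr]
    exact hM j
  intro θ hθ0 hθ1 hform
  set a := D.alphaBar τ θ with ha
  have ha' : a = D.sigma τ / (ρ ^ 2 * (1 - θ) ^ 2) := by
    rw [ha, PADMM.Data.alphaBar, hρdef, mul_pow, Real.sq_sqrt (by positivity)]
    congr 1
    ring
  have ha0 : 0 < a := by
    have : 0 < 1 - θ := by linarith
    rw [ha']
    positivity
  have hrec : ∀ j, 0 < e (K + (j + 1)) →
      e (K + (j + 1)) + a * e (K + (j + 1)) ^ (2 * θ) ≤ e (K + j) := fun j hj => by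
    rw [ha']
    exact PADMM.kl_recurrence hσ hρ hθ1 hform hdesc (hη (K + j + 1) (by omega))
      (hKLK (K + j + 1) (by omega)) hj
  have hz : ∀ j, e (K + (j + 1)) = 0 → ‖u (K + 2 + j) - us‖ = 0 := fun j hj => by
    rw [show K + 2 + j = K + (j + 1) + 1 by omega]
    exact PADMM.kl_eq_limit_of_eq_zero hψ hσ hdesc he (hbound (K + (j + 1) + 1) (by omega)) hj
  have hM' : ∀ j, ‖u (K + 2 + j) - us‖ ≤ (1 / Real.sqrt (D.sigma τ) + ρ / D.sigma τ) *
      max (e (K + j) ^ (1 - θ)) (Real.sqrt (e (K + j))) := fun j => by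
    rw [← hform _ ⟨he _, hη _ (by omega)⟩]
    exact hM j
  have heK : ∀ j, 0 ≤ e (K + j) := fun j => he _
  refine ⟨fun hθ => ?_, fun hθpos hθh => ?_, fun hθh => ?_⟩
  · subst hθ
    obtain ⟨J, hJ⟩ := PADMM.eventually_zero_of_recurrence (E := fun j => e (K + j)) ha0 heK
      (hlim0.comp (Filter.tendsto_add_atTop_nat K |>.congr fun j => add_comm j K))
      (fun j hj => by simpa using hrec j hj)
    refine ⟨K + 2 + J, fun k hk => ?_⟩
    obtain ⟨j, rfl⟩ := Nat.exists_eq_add_of_le (show K + 2 ≤ k by omega)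
    exact sub_eq_zero.1 (norm_eq_zero.1 (hz j (hJ j (by omega))))
  -- With E j = e (K + j), E 0 is the error at k₀ - 1 and E 1 the error at k₀.
  · obtain ⟨⟨C, hC, hCb⟩, C', r', hC', hr0, hr1, hCr⟩ := PADMM.linear_rate
      (M := fun j => ‖u (K + 2 + j) - us‖) (E := fun j => e (K + j)) hc ha0 hθh heK hrec hM' hz
    refine ⟨⟨C, hC, fun k hk => ?_⟩, C' / r' ^ (K + 2), r', by positivity, hr0, hr1,
      fun k hk => ?_⟩ <;> obtain ⟨j, rfl⟩ := Nat.exists_eq_add_of_le hk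
    · rw [herr (K + 1), Nat.add_sub_cancel_left]
      exact hCb j
    · refine (hCr j).trans (le_of_eq ?_)
      rw [pow_add]
      field_simp
      ring
  · obtain ⟨C, μ, hC, hμ, hCb⟩ := PADMM.sublinear_rate
      (M := fun j => ‖u (K + 2 + j) - us‖) (E := fun j => e (K + j)) hc ha0 hθh hθ1 heK hrec hM'
    refine ⟨⟨C, μ, hC, hμ, fun k hk => ?_⟩, ?_⟩
    · obtain ⟨j, rfl⟩ := Nat.exists_eq_add_of_le hk
      have h5 := hCb j
      rw [show K + 2 - 1 = K + 1 by omega, herr]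
      push_cast at h5 ⊢
      rw [add_sub_cancel_left]
      exact h5
    · have hγ : 0 ≤ (1 - θ) / (2 * θ - 1) := div_nonneg (by linarith) (by linarith)
      refine Asymptotics.IsBigO.of_bound
        (C * (μ / ((K + 2 : ℕ) + 1)) ^ (-((1 - θ) / (2 * θ - 1)))) ?_
      filter_upwards [Filter.eventually_ge_atTop (K + 2)] with k hk
      obtain ⟨j, rfl⟩ := Nat.exists_eq_add_of_le hk
      have h5 := PADMM.rpow_affine_le hγ hμ (Real.rpow_nonneg (he K) (1 - 2 * θ)) (K + 2) j
        (by omega)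
      rw [Real.norm_eq_abs, abs_of_nonneg (Real.rpow_nonneg (Nat.cast_nonneg _) _), mul_assoc]
      exact (hCb j).trans (mul_le_mul_of_nonneg_left h5 hC.le)
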